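/- Let $q$ be a prime power, let $d, m$ be integers with $1 \le m < d/2$, and let $V$ be a $d$-dimensional vector space over $\mathbb{F}_q$. Let $\Omega$ be one of the two sets $$\Omega^{\oplus} = \{\{U,W\} : U, W \le V,\ \dim U = m,\ \dim W = d-m,\ U \oplus W = V\},$$ $$\Omega^{\le} = \{\{U,W\} : U, W \le V,\ \dim U = m,\ \dim W = d-m,\ U \le W\},$$ and let $n = |\Omega|$. Let $G$ be an almost simple subgroup of $\mathrm{Sym}(\Omega)$ whose socle is $\mathrm{PSL}_d(q)$ in its natural action on $\Omega$ (that is, the socle of $G$ is the group of permutations of $\Omega$ induced by $\mathrm{SL}(V)$). Then $$\mathrm{I}(G,\Omega) < 5(\log_2 n - 1).$$ Here $\mathrm{I}(G,\Omega)$ is the maximal length of an irredundant base of $G$, that is, of a sequence $(\omega_1,\dots,\omega_l)$ of points of $\Omega$ such that $G > G_{\omega_1} > G_{\omega_1,\omega_2} > \cdots > G_{\omega_1,\dots,\omega_l} = 1$. -/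

import Mathlib

/-! ### Bases of group actions -/

section Bases

variable (G : Type*) [Group G] {Ω : Type*} [MulAction G Ω]

/-- The pointwise stabilizer in `G` of all the points of a finite sequence. -/
def seqStabilizer (l : List Ω) : Subgroup G :=
  fixingSubgroup G {x | x ∈ l}

/-- Each point of the sequence strictly decreases the stabilizer of the preceding ones:
`G > G_{ω₁} > G_{ω₁,ω₂} > ⋯`. -/
def IsStrictSeq (l : List Ω) : Prop :=
  ∀ i < l.length, seqStabilizer G (l.take (i + 1)) < seqStabilizer G (l.take i)

/-- A base is a finite sequence of points whose pointwise stabilizer is trivial; it is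
irredundant if `G > G_{ω₁} > G_{ω₁,ω₂} > ⋯ > G_{ω₁,…,ωₗ} = 1`. -/
def IsIrredundantBase (l : List Ω) : Prop :=
  IsStrictSeq G l ∧ seqStabilizer G l = ⊥

variable (Ω) in
/-- `I(G, Ω)`: the maximal length of an irredundant base for the action of `G` on `Ω`.
(The maximum exists for faithful actions of finite groups, see
`isGreatest_maxIrredundantBase`.) -/
noncomputable def maxIrredundantBase : ℕ :=
  sSup {k : ℕ | ∃ l : List Ω, IsIrredundantBase G l ∧ l.length = k}

variable {G} in
theorem IsStrictSeq.length_lt_card [Finite G] {l : List Ω} (hl : IsStrictSeq G l) :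
    l.length < Nat.card G := by
  have key : ∀ i ≤ l.length, Nat.card (seqStabilizer G (l.take i)) + i ≤ Nat.card G := by
    intro i
    induction i with
    | zero => intro _; simpa using Subgroup.card_le_card_group _
    | succ i ih =>
      intro hi
      have h1 := ih (by omega)
      have h2 : Nat.card (seqStabilizer G (l.take (i + 1))) <
          Nat.card (seqStabilizer G (l.take i)) :=
        Set.ncard_lt_ncard (hl i (by omega)) (Set.toFinite _)
      omega
  have h := key l.length le_rfl
  have : 0 < Nat.card (seqStabilizer G (l.take l.length)) := Nat.card_pos
  omega

theorem isGreatest_maxIrredundantBase [Finite G] [FaithfulSMul G Ω] :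
    IsGreatest {k : ℕ | ∃ l : List Ω, IsIrredundantBase G l ∧ l.length = k}
      (maxIrredundantBase G Ω) := by
  have hb : BddAbove {k : ℕ | ∃ l : List Ω, IsIrredundantBase G l ∧ l.length = k} :=
    ⟨Nat.card G, by rintro k ⟨l, hl, rfl⟩; exact hl.1.length_lt_card.le⟩
  have hb' : BddAbove {k : ℕ | ∃ l : List Ω, IsStrictSeq G l ∧ l.length = k} :=
    ⟨Nat.card G, by rintro k ⟨l, hl, rfl⟩; exact hl.length_lt_card.le⟩
  refine ⟨Nat.sSup_mem ?_ hb, fun k hk => le_csSup hb hk⟩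
  obtain ⟨l, hl, hmax⟩ := Nat.sSup_mem (s := {k : ℕ | ∃ l : List Ω, IsStrictSeq G l ∧ l.length = k})
    ⟨0, [], by simp [IsStrictSeq], rfl⟩ hb'
  refine ⟨l.length, l, ⟨hl, ?_⟩, rfl⟩
  by_contra hne
  obtain ⟨⟨g, hg⟩, hg'⟩ := Subgroup.ne_bot_iff_exists_ne_one.1 hne
  have hg1 : g ≠ 1 := fun h => hg' (Subtype.ext h)
  obtain ⟨x, hx⟩ : ∃ x : Ω, g • x ≠ x := by
    by_contra! h
    exact hg1 (FaithfulSMul.eq_of_smul_eq_smul (α := Ω) fun x => by simp [h x])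
  have hl' : IsStrictSeq G (l ++ [x]) := by
    intro i hi
    rcases Nat.lt_or_ge i l.length with h | h
    · rw [List.take_append_of_le_length h, List.take_append_of_le_length h.le]
      exact hl i h
    · have hi' : i = l.length := by simp at hi; omega
      subst hi'
      rw [List.take_of_length_le (by simp), List.take_append_of_le_length le_rfl,
        List.take_length]
      refine lt_of_le_of_ne (fun a ha => ?_) fun h => ?_
      · simp only [seqStabilizer, mem_fixingSubgroup_iff, Set.mem_ofPred_eq] at ha ⊢
        exact fun y hy => ha y (by simp [hy])
      · rw [← h] at hg
        simp only [seqStabilizer, mem_fixingSubgroup_iff, Set.mem_ofPred_eq] at hg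
        exact hx (hg x (by simp))
  have := le_csSup hb' ⟨l ++ [x], hl', rfl⟩
  rw [← hmax] at this
  simp at this

end Bases

/-! ### Socles and almost simple groups -/

/-- A minimal normal subgroup: minimal among the nontrivial normal subgroups. -/
def IsMinimalNormal {G : Type*} [Group G] (N : Subgroup G) : Prop :=
  Minimal (fun M : Subgroup G => M.Normal ∧ M ≠ ⊥) N

/-- The socle: the subgroup generated by all minimal normal subgroups. -/
def groupSocle (G : Type*) [Group G] : Subgroup G :=
  sSup {N | IsMinimalNormal N}

universe u in
/-- `G` is almost simple: up to isomorphism, `Inn(S) ≤ G ≤ Aut(S)` for a nonabelian simple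
group `S`. -/
def IsAlmostSimple (G : Type u) [Group G] : Prop :=
  ∃ (S : Type u) (_ : Group S) (φ : G →* MulAut S), IsSimpleGroup S ∧
    (∃ a b : S, a * b ≠ b * a) ∧ Function.Injective φ ∧
    (MulAut.conj : S →* MulAut S).range ≤ φ.range

/-! ### Pairs of subspaces -/

section Pairs

variable (K V : Type*) [Field K] [AddCommGroup V] [Module K V]

/-- The unordered pairs `{U, W}` of subspaces of `V` with `dim U = m`, `dim W = dim V - m`
and `V = U ⊕ W`. -/
def complementaryPairs (m : ℕ) : Set (Sym2 (Submodule K V)) :=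
  {p | ∃ U W : Submodule K V, p = s(U, W) ∧ Module.finrank K U = m ∧
    Module.finrank K W = Module.finrank K V - m ∧ IsCompl U W}

/-- The unordered pairs `{U, W}` of subspaces of `V` with `dim U = m`, `dim W = dim V - m`
and `U ≤ W`. -/
def nestedPairs (m : ℕ) : Set (Sym2 (Submodule K V)) :=
  {p | ∃ U W : Submodule K V, p = s(U, W) ∧ Module.finrank K U = m ∧
    Module.finrank K W = Module.finrank K V - m ∧ U ≤ W}

variable {K V}

/-- The image `{g U, g W}` of an unordered pair `{U, W}` of subspaces. -/
def mapPair (g : V ≃ₗ[K] V) (p : Sym2 (Submodule K V)) : Sym2 (Submodule K V) :=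
  p.map (Submodule.map (g : V →ₗ[K] V))

/-- The set `Ω` of pairs of subspaces is preserved by all invertible linear maps. -/
def LinearlyInvariant (Ω : Set (Sym2 (Submodule K V))) : Prop :=
  ∀ (g : V ≃ₗ[K] V), ∀ p ∈ Ω, mapPair g p ∈ Ω

theorem complementaryPairs_invariant (m : ℕ) :
    LinearlyInvariant (complementaryPairs K V m) := by
  rintro g _ ⟨U, W, rfl, hU, hW, h⟩
  exact ⟨_, _, rfl, (LinearEquiv.finrank_map_eq g U).trans hU,
    (LinearEquiv.finrank_map_eq g W).trans hW,
    (Submodule.orderIsoMapComap g).isCompl h⟩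

theorem nestedPairs_invariant (m : ℕ) :
    LinearlyInvariant (nestedPairs K V m) := by
  rintro g _ ⟨U, W, rfl, hU, hW, h⟩
  exact ⟨_, _, rfl, (LinearEquiv.finrank_map_eq g U).trans hU,
    (LinearEquiv.finrank_map_eq g W).trans hW, Submodule.map_mono h⟩

theorem mapPair_one (p : Sym2 (Submodule K V)) : mapPair (1 : V ≃ₗ[K] V) p = p := by
  induction p with
  | h U W =>
    have h : ∀ U : Submodule K V, U.map ((1 : V ≃ₗ[K] V) : V →ₗ[K] V) = U := fun U =>
      Submodule.map_id U
    simp only [mapPair, Sym2.map_mk, h]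

theorem mapPair_mul (g h : V ≃ₗ[K] V) (p : Sym2 (Submodule K V)) :
    mapPair (g * h) p = mapPair g (mapPair h p) := by
  induction p with
  | h U W =>
    have h : ∀ U : Submodule K V, U.map ((g * h : V ≃ₗ[K] V) : V →ₗ[K] V) =
        (U.map (h : V →ₗ[K] V)).map (g : V →ₗ[K] V) := fun U =>
      Submodule.map_comp (h : V →ₗ[K] V) (g : V →ₗ[K] V) U
    simp only [mapPair, Sym2.map_mk, h]

/-- The natural action of `SL(V)` on an invariant set of pairs of subspaces. -/
def slPerm (Ω : Set (Sym2 (Submodule K V))) (hΩ : LinearlyInvariant Ω) :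
    SpecialLinearGroup K V →* Equiv.Perm Ω :=
  MonoidHom.toHomPerm
    { toFun := fun g p => ⟨mapPair (g : V ≃ₗ[K] V) p, hΩ g p p.2⟩
      map_one' := by
        funext p
        exact Subtype.ext (mapPair_one _)
      map_mul' := fun g h => by
        funext p
        exact Subtype.ext (mapPair_mul _ _ _) }

variable (K V) in
/-- `PSL(V)`, the quotient of `SL(V)` by its centre. -/
abbrev ProjectiveSL : Type _ :=
  SpecialLinearGroup K V ⧸ Subgroup.center (SpecialLinearGroup K V)

theorem center_le_ker_slPerm [FiniteDimensional K V] (Ω : Set (Sym2 (Submodule K V)))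
    (hΩ : LinearlyInvariant Ω) :
    Subgroup.center (SpecialLinearGroup K V) ≤ (slPerm Ω hΩ).ker := by
  intro g hg
  obtain ⟨r, -, h⟩ := SpecialLinearGroup.mem_center_iff.1 hg
  have hr : r ≠ 0 ∨ Subsingleton V := by
    rcases eq_or_ne r 0 with rfl | hr
    · refine Or.inr ⟨fun x y => (g : V ≃ₗ[K] V).injective ?_⟩
      have h' := fun x => LinearMap.congr_fun h x
      simp only [LinearEquiv.coe_coe, zero_smul, LinearMap.zero_apply] at h'
      rw [h', h']
    · exact Or.inl hr
  have hmap : ∀ U : Submodule K V, U.map ((g : V ≃ₗ[K] V) : V →ₗ[K] V) = U := by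
    intro U
    rcases hr with hr | hV
    · rw [h, Submodule.map_smul _ _ _ hr, Submodule.map_id]
    · exact Subsingleton.elim _ _
  refine MonoidHom.mem_ker.2 (Equiv.ext fun p => Subtype.ext ?_)
  obtain ⟨p, hp⟩ := p
  change mapPair (g : V ≃ₗ[K] V) p = p
  clear hp
  induction p with
  | h U W => simp only [mapPair, Sym2.map_mk, hmap]

/-- The natural action of `PSL(V)` on an invariant set of pairs of subspaces. -/
def pslPerm [FiniteDimensional K V] (Ω : Set (Sym2 (Submodule K V)))
    (hΩ : LinearlyInvariant Ω) : ProjectiveSL K V →* Equiv.Perm Ω :=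
  QuotientGroup.lift _ (slPerm Ω hΩ) (center_le_ker_slPerm Ω hΩ)

end Pairs

/-! Write `S` for the image of `SL(V)` in `G`, `d = dim V`, `q = |K|`. Three estimates are combined:
the length `l` of a chain of stabilizers is at most a dimension count plus `log₂ [G : S]`; the index
`[G : S]` is at most `2 (q - 1) ^ (2d - 1)`; and `n ≥ q ^ (m (2d - 3m))`.

Length (`chain_bound`, `length_bound`). At each step of a strict chain either the intersection with
`S` shrinks, or it does not and then the index of that intersection in the stabilizer at least
halves; the second case costs at most `log₂ [G : S]` steps. Since `m ≠ d - m`, the elements of `S`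
fixing a pair preserve both of its members, so a shrinking step makes the algebra of endomorphisms
preserving all members so far drop. Its dimension goes from `d ^ 2` down to at least `1`, giving the
bound `d ^ 2 - 1`. For small `m` a sharper count uses `potential`: with `Y` the sum of the small
subspaces `U` so far, `(m + 1) dim Y - dim (𝒜|Y)` never decreases, because new directions `C ≤ U`
bring in at most `dim Hom(C, U) ≤ m dim C` new parameters. The large subspaces `W` are treated in
the same way through their `m`-dimensional annihilators, for a total of `2 (m + 1) d`.

Index (`index_range_le`). Bounding `[G : S]` amounts to bounding the outer automorphisms of `PSL(V)`
that occur. Transvections are recognised group-theoretically as nontrivial central elements of Sylow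
`p`-subgroups (`conj_tv`), and sharing a centre or an axis is seen from products (`rel_iff`). Hence
conjugation by `g ∈ G` carries the grid of root elements to a grid of the same kind, with rows and
columns kept or exchanged (`rook_dichotomy`). After correction by `S`, `g` acts on root elements by
changing scalars, up to transposition, and is determined by its effect on `2d - 1` generators of
`SL(V)`, because the socle of an almost simple group has trivial centralizer.

Cardinality (`pow_le_card_pairs`). Distinct pairs are produced from one pair by shears. The final
comparison is `two_pow_lt_of_bounds`. -/

set_option linter.unusedSectionVars false

open Module

/-! ### Transvections, their commutation and conjugation -/

section Transvections

variable {K V : Type*} [Field K] [AddCommGroup V] [Module K V]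

theorem SL_ext {g h : SpecialLinearGroup K V} (e : ∀ x : V, g • x = h • x) : g = h :=
  SpecialLinearGroup.ext _ _ e

theorem SL_smul_smul (g : SpecialLinearGroup K V) (a : K) (x : V) : g • a • x = a • g • x :=
  map_smul (g : V ≃ₗ[K] V) a x

/-- The contragredient action of `SL(V)` on linear forms. -/
noncomputable def contra (g : SpecialLinearGroup K V) (f : Dual K V) : Dual K V :=
  f ∘ₗ ((g⁻¹ : SpecialLinearGroup K V) : V ≃ₗ[K] V).toLinearMap

@[simp] theorem contra_apply (g : SpecialLinearGroup K V) (f : Dual K V) (x : V) :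
    contra g f x = f (g⁻¹ • x) := rfl

variable [FiniteDimensional K V]

/-- The transvection `x ↦ x + f x • v`, as an element of `SL(V)`
(the identity if `f v ≠ 0`). -/
noncomputable def tv (v : V) (f : Dual K V) : SpecialLinearGroup K V :=
  open Classical in
  if h : f v = 0 then ⟨LinearEquiv.transvection h, LinearEquiv.transvection.det_eq_one h⟩ else 1

theorem tv_apply {v : V} {f : Dual K V} (h : f v = 0) (x : V) : tv v f • x = x + f x • v := by
  simp only [tv, h, dif_pos]
  rfl

theorem tv_mul_left {v : V} {f f' : Dual K V} (h : f v = 0) (h' : f' v = 0) :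
    tv v f * tv v f' = tv v (f + f') := by
  refine SL_ext fun x => ?_
  rw [tv_apply (by simp [h, h']), mul_smul, tv_apply h, tv_apply h']
  simp [h, add_smul]
  abel

theorem tv_mul_right {v v' : V} {f : Dual K V} (h : f v = 0) (h' : f v' = 0) :
    tv v f * tv v' f = tv (v + v') f := by
  refine SL_ext fun x => ?_
  rw [tv_apply (by simp [h, h']), mul_smul, tv_apply h, tv_apply h']
  simp [h']
  abel

theorem tv_smul {v : V} {f : Dual K V} (a : K) (h : f v = 0) : tv (a • v) f = tv v (a • f) := by
  refine SL_ext fun x => ?_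
  rw [tv_apply (by simp [h]), tv_apply (by simp [h])]
  simp [smul_smul, mul_comm]

@[simp] theorem tv_zero_right (v : V) : tv v (0 : Dual K V) = 1 := by
  refine SL_ext fun x => ?_
  rw [tv_apply (by simp)]
  simp

@[simp] theorem tv_zero_left (f : Dual K V) : tv 0 f = 1 := by
  refine SL_ext fun x => ?_
  rw [tv_apply (by simp)]
  simp

theorem tv_inv {v : V} {f : Dual K V} (h : f v = 0) : (tv v f)⁻¹ = tv v (-f) := by
  rw [inv_eq_iff_mul_eq_one, tv_mul_left h (by simp [h])]
  simp

theorem tv_pow {v : V} {f : Dual K V} (h : f v = 0) (n : ℕ) : tv v f ^ n = tv v (n • f) := by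
  induction n with
  | zero => simp
  | succ n ih =>
    rw [pow_succ, ih, tv_mul_left (by simp [h]) h, succ_nsmul]

theorem tv_pow_char (p : ℕ) [CharP K p] {v : V} {f : Dual K V} (h : f v = 0) :
    tv v f ^ p = 1 := by
  rw [tv_pow h, ← Nat.cast_smul_eq_nsmul K, CharP.cast_eq_zero, zero_smul, tv_zero_right]

theorem tv_conj (g : SpecialLinearGroup K V) {v : V} {f : Dual K V} (h : f v = 0) :
    g * tv v f * g⁻¹ = tv (g • v) (contra g f) := by
  refine SL_ext fun x => ?_
  rw [tv_apply (by simpa using h), mul_smul, mul_smul, tv_apply h, smul_add, SL_smul_smul]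
  simp

theorem exists_apply_ne_zero {f : Dual K V} (hf : f ≠ 0) : ∃ x, f x ≠ 0 := by
  by_contra! H
  exact hf (LinearMap.ext H)

theorem tv_ne_one {v : V} {f : Dual K V} (h : f v = 0) (hv : v ≠ 0) (hf : f ≠ 0) :
    tv v f ≠ 1 := by
  intro e
  obtain ⟨x, hx⟩ := exists_apply_ne_zero hf
  have := congrArg (fun s : SpecialLinearGroup K V => s • x) e
  simp only [tv_apply h] at this
  simp_all

/-- Comparing the two products at `x` leaves `f' x f(v') v = f x f'(v) v'`. Applying `f` at a point
where `f' ≠ 0` forces `f v' = 0`, and then `f' v = 0` follows. -/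
theorem tv_commute_iff {v v' : V} {f f' : Dual K V} (h : f v = 0) (h' : f' v' = 0)
    (hv : v ≠ 0) (hv' : v' ≠ 0) (hf : f ≠ 0) (hf' : f' ≠ 0) :
    Commute (tv v f) (tv v' f') ↔ f v' = 0 ∧ f' v = 0 := by
  have key : Commute (tv v f) (tv v' f') ↔ ∀ x, (f' x * f v') • v = (f x * f' v) • v' := by
    have : Commute (tv v f) (tv v' f') ↔
        ∀ x, (tv v f * tv v' f') • x = (tv v' f' * tv v f) • x :=
      ⟨fun e x => by rw [e.eq], fun e => SL_ext e⟩
    rw [this]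
    refine forall_congr' fun x => ?_
    rw [mul_smul, mul_smul, tv_apply h, tv_apply h', tv_apply h, tv_apply h']
    simp only [map_add, map_smul, smul_eq_mul, add_smul]
    constructor
    · intro e
      have := sub_eq_zero.2 e
      rw [← sub_eq_zero, ← this]
      abel
    · intro e
      rw [e]
      abel
  rw [key]
  constructor
  · intro e
    obtain ⟨x, hx⟩ := exists_apply_ne_zero hf
    obtain ⟨y, hy⟩ := exists_apply_ne_zero hf'
    have h1 : f v' = 0 := by
      have h3 := congrArg f (e y)
      simp only [map_smul, h, smul_eq_mul, mul_zero] at h3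
      by_contra h1
      have h2 := e y
      rw [(mul_eq_zero.1 h3.symm).resolve_right h1, zero_smul] at h2
      exact smul_ne_zero (mul_ne_zero hy h1) hv h2
    refine ⟨h1, ?_⟩
    have h2 := e x
    rw [h1, mul_zero, zero_smul] at h2
    exact (mul_eq_zero.1 ((smul_eq_zero.1 h2.symm).resolve_right hv')).resolve_left hx
  · rintro ⟨h1, h2⟩ x
    simp [h1, h2]

omit [FiniteDimensional K V] in
theorem mem_span_of_forall_dual {v w : V}
    (H : ∀ h : Dual K V, h v = 0 → h w = 0) : w ∈ Submodule.span K {v} := by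
  by_contra hw
  obtain ⟨f, hf, hf'⟩ := Submodule.exists_le_ker_of_notMem hw
  exact hf (H f (hf' (Submodule.mem_span_singleton_self v)))

theorem mem_span_of_ker_le {f g : Dual K V} (H : ∀ u, f u = 0 → g u = 0) :
    g ∈ Submodule.span K {f} := by
  have := mem_span_of_iInf_ker_le_ker (ι := Unit) (L := fun _ => f) (K := g) (by
    intro x hx
    simpa using H x (by simpa using hx))
  simpa using this

/-- The group of transvections with centre spanned by `v`. -/
noncomputable def centreGroup (v : V) : Subgroup (SpecialLinearGroup K V) where
  carrier := {g | ∃ f : Dual K V, f v = 0 ∧ g = tv v f}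
  mul_mem' := by
    rintro _ _ ⟨f, hf, rfl⟩ ⟨f', hf', rfl⟩
    exact ⟨f + f', by simp [hf, hf'], tv_mul_left hf hf'⟩
  one_mem' := ⟨0, by simp, by simp⟩
  inv_mem' := by
    rintro _ ⟨f, hf, rfl⟩
    exact ⟨-f, by simp [hf], tv_inv hf⟩

/-- The group of transvections with axis the kernel of `f`. -/
noncomputable def axisGroup (f : Dual K V) : Subgroup (SpecialLinearGroup K V) where
  carrier := {g | ∃ v : V, f v = 0 ∧ g = tv v f}
  mul_mem' := by
    rintro _ _ ⟨v, hv, rfl⟩ ⟨v', hv', rfl⟩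
    exact ⟨v + v', by simp [hv, hv'], tv_mul_right hv hv'⟩
  one_mem' := ⟨0, by simp, by simp⟩
  inv_mem' := by
    rintro _ ⟨v, hv, rfl⟩
    refine ⟨-v, by simp [hv], ?_⟩
    rw [inv_eq_iff_mul_eq_one, tv_mul_right hv (by simp [hv])]
    simp

theorem mem_centreGroup {v : V} {f : Dual K V} (h : f v = 0) : tv v f ∈ centreGroup (K := K) v :=
  ⟨f, h, rfl⟩

theorem mem_axisGroup {v : V} {f : Dual K V} (h : f v = 0) : tv v f ∈ axisGroup f :=
  ⟨v, h, rfl⟩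

theorem centreGroup_isPGroup (p : ℕ) [CharP K p] (v : V) :
    IsPGroup p (centreGroup (K := K) v) := by
  rintro ⟨_, f, hf, rfl⟩
  exact ⟨1, Subtype.ext (by simpa using tv_pow_char p hf)⟩

theorem axisGroup_isPGroup (p : ℕ) [CharP K p] (f : Dual K V) : IsPGroup p (axisGroup f) := by
  rintro ⟨_, v, hv, rfl⟩
  exact ⟨1, Subtype.ext (by simpa using tv_pow_char p hv)⟩

theorem le_normalizer_of_conj_mem {G : Type*} [Group G] {P H : Subgroup G}
    (h : ∀ g ∈ P, ∀ x ∈ H, g * x * g⁻¹ ∈ H) : P ≤ Subgroup.normalizer H := by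
  intro g hg
  rw [Subgroup.mem_normalizer_iff]
  refine fun x => ⟨h g hg x, fun hx => ?_⟩
  have := h g⁻¹ (P.inv_mem hg) _ hx
  simpa [mul_assoc] using this

theorem le_normalizer_centreGroup {P : Subgroup (SpecialLinearGroup K V)} {v : V}
    (hP : ∀ g ∈ P, g • v = v) : P ≤ Subgroup.normalizer (centreGroup (K := K) v) := by
  refine le_normalizer_of_conj_mem ?_
  rintro g hg _ ⟨f, hf, rfl⟩
  rw [tv_conj g hf, hP g hg]
  refine mem_centreGroup ?_
  rw [contra_apply, hP _ (P.inv_mem hg), hf]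

theorem le_normalizer_axisGroup {P : Subgroup (SpecialLinearGroup K V)} {f : Dual K V}
    (hP : ∀ g ∈ P, ∀ x, f (g • x) = f x) : P ≤ Subgroup.normalizer (axisGroup f) := by
  refine le_normalizer_of_conj_mem ?_
  rintro g hg _ ⟨v, hv, rfl⟩
  have e : contra g f = f := LinearMap.ext fun x => hP _ (P.inv_mem hg) x
  rw [tv_conj g hv, e]
  exact mem_axisGroup (by rw [hP g hg, hv])

end Transvections

/-! ### Sylow subgroups in the defining characteristic -/

section Sylow

variable {K V : Type*} [Field K] [Finite K] [AddCommGroup V] [Module K V] [FiniteDimensional K V]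

theorem IsPGroup.exists_ne_zero_fixed (p : ℕ) [Fact p.Prime] [CharP K p] {P : Type*} [Group P]
    (hP : IsPGroup p P) (W : Type*) [AddCommGroup W] [Module K W] [FiniteDimensional K W]
    [Nontrivial W] [MulAction P W] (h0 : ∀ g : P, g • (0 : W) = 0) :
    ∃ w : W, w ≠ 0 ∧ ∀ g : P, g • w = w := by
  have : Finite W := Module.finite_of_finite K
  have hp : p ∣ Nat.card W := by
    rw [Module.natCard_eq_pow_finrank (K := K)]
    refine dvd_pow ?_ Module.finrank_pos.ne'
    have := Fintype.ofFinite K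
    rw [Nat.card_eq_fintype_card]
    obtain ⟨n, hp, h⟩ := FiniteField.card K p
    rw [h]
    exact dvd_pow_self p n.ne_zero
  obtain ⟨w, hw, hne⟩ := hP.exists_fixed_point_of_prime_dvd_card_of_fixed_point W hp
    (a := 0) (fun g => h0 g)
  exact ⟨w, hne.symm, hw⟩

/-- A `p`-group acting on a nonzero finite `K`-space and fixing `0` fixes another vector, by
counting modulo `p`. This is applied to the dual space, then to the kernel of the fixed form, which
is nonzero since `dim V ≥ 2`. -/
theorem exists_fixed_flag (p : ℕ) [Fact p.Prime] [CharP K p] (hd : 2 ≤ finrank K V)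
    {P : Subgroup (SpecialLinearGroup K V)} (hP : IsPGroup p P) :
    ∃ (v : V) (f : Dual K V), v ≠ 0 ∧ f ≠ 0 ∧ f v = 0 ∧ (∀ g ∈ P, g • v = v) ∧
      ∀ g ∈ P, ∀ x, f (g • x) = f x := by
  obtain ⟨f, hf, hfix⟩ : ∃ f : Dual K V, f ≠ 0 ∧ ∀ g ∈ P, ∀ x, f (g • x) = f x := by
    let : MulAction P (Dual K V) :=
      { smul := fun g f => contra g f
        one_smul := fun f => by
          ext x
          change f ((((1 : P) : SpecialLinearGroup K V)⁻¹ : SpecialLinearGroup K V) • x) = f x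
          simp
        mul_smul := fun g h f => by
          ext x
          change f ((((g * h : P) : SpecialLinearGroup K V)⁻¹ : SpecialLinearGroup K V) • x) =
            f ((h⁻¹ : SpecialLinearGroup K V) • (g⁻¹ : SpecialLinearGroup K V) • x)
          simp [mul_smul] }
    have hV : Nontrivial V := Module.nontrivial_of_finrank_pos (R := K) (by omega)
    have : Nontrivial (Dual K V) := by
      apply Module.nontrivial_of_finrank_pos (R := K)
      rw [Subspace.dual_finrank_eq]; omega
    obtain ⟨f, hf, h⟩ := hP.exists_ne_zero_fixed (K := K) p (Dual K V)
      (fun g => LinearMap.zero_comp _)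
    refine ⟨f, hf, fun g hg x => ?_⟩
    have := h ⟨g⁻¹, P.inv_mem hg⟩
    have := LinearMap.congr_fun this x
    change f ((g⁻¹⁻¹ : SpecialLinearGroup K V) • x) = f x at this
    simpa using this
  obtain ⟨v, hv, hvf, hvfix⟩ : ∃ v : V, v ≠ 0 ∧ f v = 0 ∧ ∀ g ∈ P, g • v = v := by
    let : MulAction P (LinearMap.ker f) :=
      { smul := fun g w => ⟨(g : SpecialLinearGroup K V) • (w : V), by
          rw [LinearMap.mem_ker, hfix g g.2]; exact w.2⟩
        one_smul := fun w => Subtype.ext (one_smul _ _)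
        mul_smul := fun g h w => Subtype.ext (mul_smul _ _ _) }
    have : Nontrivial (LinearMap.ker f) := by
      apply Module.nontrivial_of_finrank_pos (R := K)
      have h1 := f.finrank_range_add_finrank_ker
      have h2 : finrank K (LinearMap.range f) ≤ 1 := by
        simpa using Submodule.finrank_le (LinearMap.range f)
      omega
    obtain ⟨w, hw, h⟩ := hP.exists_ne_zero_fixed (K := K) p (LinearMap.ker f)
      (fun g => Subtype.ext (smul_zero (g : SpecialLinearGroup K V)))
    exact ⟨w, by simpa using hw, w.2, fun g hg => congrArg Subtype.val (h ⟨g, hg⟩)⟩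
  exact ⟨v, f, hv, hf, hvf, hvfix, hfix⟩

/-- The centre of a Sylow subgroup of `SL(V)` in the defining characteristic consists of
the transvections with a given centre and a given axis. -/
theorem exists_sylow_center (p : ℕ) [Fact p.Prime] [CharP K p] (hd : 2 ≤ finrank K V)
    (P : Sylow p (SpecialLinearGroup K V)) :
    ∃ (v : V) (f : Dual K V), v ≠ 0 ∧ f ≠ 0 ∧ f v = 0 ∧ ∀ z : SpecialLinearGroup K V,
      (z ∈ P ∧ ∀ x ∈ P, Commute z x) ↔ ∃ a : K, z = tv v (a • f) := by
  obtain ⟨v, f, hv, hf, hvf, hPv, hPf⟩ := exists_fixed_flag p hd P.2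
  -- `P` normalizes the `p`-group `centreGroup v`, so their join is a `p`-group and equals `P` by
  -- maximality; likewise for the axis group.
  have hc : centreGroup v ≤ P.1 := by
    have := P.3 (P.2.to_sup_of_normal_right' (centreGroup_isPGroup p v)
      (le_normalizer_centreGroup hPv)) le_sup_left
    exact this ▸ le_sup_right
  have ha : axisGroup f ≤ P.1 := by
    have := P.3 (P.2.to_sup_of_normal_right' (axisGroup_isPGroup p f)
      (le_normalizer_axisGroup hPf)) le_sup_left
    exact this ▸ le_sup_right
  refine ⟨v, f, hv, hf, hvf, fun z => ⟨?_, ?_⟩⟩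
  · rintro ⟨hz, hcomm⟩
    -- Commuting with `tv v h` gives `h (z x) = h x`, for every form `h` vanishing on `v`.
    have h1 : ∀ x, z • x - x ∈ Submodule.span K {v} := by
      intro x
      refine mem_span_of_forall_dual fun h hh => ?_
      have e := (hcomm _ (hc (mem_centreGroup hh))).eq
      have e2 := congrArg (fun s : SpecialLinearGroup K V => s • x) e
      simp only [mul_smul] at e2
      rw [tv_apply hh, tv_apply hh, smul_add, SL_smul_smul, hPv z hz] at e2
      have e3 : (h x - h (z • x)) • v = 0 := by
        rw [sub_smul, sub_eq_zero]
        exact add_left_cancel e2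
      rw [map_sub, ← neg_eq_zero, neg_sub]
      simpa [hv] using e3
    obtain ⟨y, hy⟩ := exists_apply_ne_zero hf
    -- Commuting with `tv u f`, tested at a vector `y` off the axis, gives `z u = u`.
    have h2 : ∀ u, f u = 0 → z • u = u := by
      intro u hu
      have e := (hcomm _ (ha (mem_axisGroup hu))).eq
      have e2 := congrArg (fun s : SpecialLinearGroup K V => s • y) e
      simp only [mul_smul] at e2
      rw [tv_apply hu, tv_apply hu, smul_add, SL_smul_smul, hPf z hz] at e2
      exact smul_right_injective V hy (add_left_cancel e2)
    obtain ⟨c, hc⟩ := Submodule.mem_span_singleton.1 (h1 y)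
    refine ⟨c / f y, SL_ext fun x => ?_⟩
    rw [tv_apply (by simp [hvf])]
    have e := h2 (x - (f x / f y) • y) (by simp [hy])
    rw [smul_sub, SL_smul_smul] at e
    have e4 : z • y = y + c • v := by rw [hc]; abel
    rw [e4] at e
    simp only [LinearMap.smul_apply, smul_eq_mul]
    have e5 : z • x = x - (f x / f y) • y + (f x / f y) • (y + c • v) := by rw [← e]; abel
    rw [e5, smul_add, smul_smul]
    have : c / f y * f x = f x / f y * c := by field_simp
    rw [this]
    abel
  · rintro ⟨a, rfl⟩
    have haf : (a • f) v = 0 := by simp [hvf]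
    refine ⟨hc (mem_centreGroup haf), fun x hx => ?_⟩
    have := tv_conj x haf
    rw [hPv x hx] at this
    have e : contra x (a • f) = a • f := LinearMap.ext fun y =>
      congrArg (a • ·) (hPf _ (P.1.inv_mem hx) y)
    rw [e, mul_inv_eq_iff_eq_mul] at this
    exact this.symm

/-- The transvections with centre `v` and those with axis `ker f` generate a `p`-group. In a Sylow
subgroup containing it, a central transvection commutes with all of these, which forces its centre
and axis to be those of `tv v f`. -/
theorem exists_sylow_tv_mem_center (p : ℕ) [Fact p.Prime] [CharP K p] (hd : 2 ≤ finrank K V)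
    {v : V} {f : Dual K V} (hv : v ≠ 0) (hf : f ≠ 0) (hvf : f v = 0) :
    ∃ P : Sylow p (SpecialLinearGroup K V), tv v f ∈ P ∧ ∀ x ∈ P, Commute (tv v f) x := by
  have hn : axisGroup f ≤ Subgroup.normalizer (centreGroup (K := K) v) := by
    refine le_normalizer_centreGroup ?_
    rintro _ ⟨u, hu, rfl⟩
    rw [tv_apply hu, hvf]
    simp
  obtain ⟨P, hP⟩ := ((axisGroup_isPGroup p f).to_sup_of_normal_right'
    (centreGroup_isPGroup p v) hn).exists_le_sylow
  obtain ⟨v', f', hv', hf', hvf', hz⟩ := exists_sylow_center p hd P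
  obtain ⟨hz1, hz2⟩ := (hz (tv v' f')).2 ⟨1, by simp⟩
  have h1 : v' ∈ Submodule.span K {v} := by
    refine mem_span_of_forall_dual fun h hh => ?_
    by_cases h0 : h = 0
    · simp [h0]
    have := hz2 (tv v h) (hP (Subgroup.mem_sup_right (mem_centreGroup hh)))
    exact ((tv_commute_iff hvf' hh hv' hv hf' h0).1 this).2
  have h2 : f' ∈ Submodule.span K {f} := by
    refine mem_span_of_ker_le fun u hu => ?_
    by_cases h0 : u = 0
    · simp [h0]
    have := hz2 (tv u f) (hP (Subgroup.mem_sup_left (mem_axisGroup hu)))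
    exact ((tv_commute_iff hvf' hu hv' h0 hf' hf).1 this).1
  obtain ⟨a, rfl⟩ := Submodule.mem_span_singleton.1 h1
  obtain ⟨b, rfl⟩ := Submodule.mem_span_singleton.1 h2
  have ha : a ≠ 0 := by rintro rfl; simp at hv'
  have hb : b ≠ 0 := by rintro rfl; simp at hf'
  refine ⟨P, (hz _).2 ⟨a⁻¹ * b⁻¹, ?_⟩⟩
  rw [tv_smul _ (by simp [hvf]), smul_smul, smul_smul]
  field_simp
  simp

end Sylow

/-! ### Root elements and generation of `SL(V)` -/

section RootElements

variable {K V ι : Type*} [Field K] [AddCommGroup V] [Module K V] [FiniteDimensional K V]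
  [Fintype ι] [DecidableEq ι]

/-- The root element `1 + a E_{ij}` with respect to a basis. -/
noncomputable def rootElt (b : Basis ι K V) (i j : ι) (a : K) : SpecialLinearGroup K V :=
  tv (b i) (a • b.coord j)

variable (b : Basis ι K V)

theorem rootElt_cond {i j : ι} (h : i ≠ j) (a : K) : (a • b.coord j) (b i) = 0 := by
  simp [h]

theorem rootElt_smul {i j : ι} (h : i ≠ j) (a : K) (x : V) :
    rootElt b i j a • x = x + (a * b.repr x j) • b i := by
  rw [rootElt, tv_apply (rootElt_cond b h a)]
  simp

@[simp] theorem rootElt_zero (i j : ι) : rootElt b i j 0 = 1 := by simp [rootElt]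

/-- The commutator formula, through which root elements at adjacent positions generate those at a
third. -/
theorem rootElt_mul {i j k : ι} (hij : i ≠ j) (hjk : j ≠ k) (hik : i ≠ k) (a c : K) :
    rootElt b i k (a * c) =
      (rootElt b j k c)⁻¹ * (rootElt b i j a * rootElt b j k c * (rootElt b i j a)⁻¹) := by
  rw [eq_inv_mul_iff_mul_eq, eq_mul_inv_iff_mul_eq]
  refine SL_ext fun x => ?_
  simp only [mul_smul, rootElt_smul b hij, rootElt_smul b hjk, rootElt_smul b hik]
  simp [hik]
  module

theorem SL_eq_one_of_basis {g : SpecialLinearGroup K V} (h : ∀ i, g • b i = b i) : g = 1 := by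
  have : ((g : V ≃ₗ[K] V) : V →ₗ[K] V) = LinearMap.id := b.ext h
  exact SL_ext fun x => by
    rw [one_smul]
    exact LinearMap.congr_fun this x

/-- Induction on the set `s` of positions other than `i₀` where the diagonal entry may differ from
`1`: each is normalized to `1` at the expense of the entry at `i₀`, which the determinant finally
forces to be `1`. -/
theorem mem_of_diagonal {H : Subgroup (SpecialLinearGroup K V)}
    (hH : ∀ i j, i ≠ j → ∀ a, rootElt b i j a ∈ H) (i₀ : ι) (s : Finset ι) (hs : i₀ ∉ s) :
    ∀ (g : SpecialLinearGroup K V) (D : ι → K), (∀ i, g • b i = D i • b i) →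
      (∀ i, i ∉ s → i ≠ i₀ → D i = 1) → g ∈ H := by
  induction s using Finset.induction_on with
  | empty =>
    intro g D hg hD
    have hdet : ∏ i, D i = 1 := by
      have h1 := g.det_eq_one
      have h2 : LinearMap.toMatrix b b ((g : V ≃ₗ[K] V) : V →ₗ[K] V) = Matrix.diagonal D := by
        ext i j
        rw [LinearMap.toMatrix_apply]
        have : ((g : V ≃ₗ[K] V) : V →ₗ[K] V) (b j) = D j • b j := hg j
        rw [this]
        by_cases hij : i = j
        · subst hij; simp
        · simp [hij, Matrix.diagonal_apply_ne]
      rw [← LinearMap.det_toMatrix b, h2, Matrix.det_diagonal] at h1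
      exact h1
    have h0 : D i₀ = 1 := by
      rw [Finset.prod_eq_single i₀ (fun i _ hi => hD i (by simp) hi) (by simp)] at hdet
      exact hdet
    have : g = 1 := SL_eq_one_of_basis b fun i => by
      rw [hg]
      by_cases hi : i = i₀
      · rw [hi, h0, one_smul]
      · rw [hD i (by simp) hi, one_smul]
    rw [this]
    exact H.one_mem
  | insert k s hk ih =>
    intro g D hg hD
    have hki : k ≠ i₀ := by rintro rfl; simp at hs
    have hs' : i₀ ∉ s := fun h => hs (Finset.mem_insert_of_mem h)
    have hDk : D k ≠ 0 := by
      intro h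
      have h1 := hg k
      rw [h, zero_smul, smul_eq_zero_iff_eq] at h1
      exact b.ne_zero k h1
    set a : K := (D k)⁻¹ with ha
    have ha0 : a ≠ 0 := inv_ne_zero hDk
    -- Steinberg's expression of the diagonal element with entries `a` at `k` and `a⁻¹` at `i₀` as a
    -- product of root elements.
    set h := rootElt b k i₀ a * rootElt b i₀ k (-a⁻¹) * rootElt b k i₀ a *
      (rootElt b k i₀ (-1) * rootElt b i₀ k 1 * rootElt b k i₀ (-1)) with hh
    have hmem : h ∈ H := by
      have := fun c => hH k i₀ hki c
      have := fun c => hH i₀ k hki.symm c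
      simp only [hh]
      refine H.mul_mem (H.mul_mem (H.mul_mem ?_ ?_) ?_) (H.mul_mem (H.mul_mem ?_ ?_) ?_) <;>
        simp only [*]
    have e1 : h • b k = a • b k := by
      simp only [hh, mul_smul, rootElt_smul b hki, rootElt_smul b hki.symm]
      simp [hki, hki.symm, ha0]
    have e2 : h • b i₀ = a⁻¹ • b i₀ := by
      simp only [hh, mul_smul, rootElt_smul b hki, rootElt_smul b hki.symm]
      simp [hki, hki.symm, ha0]
    have e3 : ∀ i, i ≠ k → i ≠ i₀ → h • b i = b i := by
      intro i h1 h2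
      simp only [hh, mul_smul, rootElt_smul b hki, rootElt_smul b hki.symm]
      simp [h1, h2]
    have key : h * g ∈ H := by
      refine ih hs' (h * g) (fun i => if i = k then 1 else if i = i₀ then D i₀ * a⁻¹ else D i)
        (fun i => ?_) (fun i hi hi0 => ?_)
      · rw [mul_smul, hg, SL_smul_smul]
        by_cases h1 : i = k
        · subst h1
          simp [e1, smul_smul, ha, hDk]
        by_cases h2 : i = i₀
        · subst h2
          simp [h1, e2, smul_smul]
        · simp [h1, h2, e3 i h1 h2]
      · by_cases h1 : i = k
        · simp [h1]
        · simp only [h1, hi0, if_false]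
          exact hD i (by simp [h1, hi]) hi0
    simpa using H.mul_mem (H.inv_mem hmem) key

theorem exists_mem_toMatrix_eq_prod {H : Subgroup (SpecialLinearGroup K V)}
    (hH : ∀ i j, i ≠ j → ∀ a, rootElt b i j a ∈ H) (L : List (Matrix.TransvectionStruct ι K)) :
    ∃ h ∈ H, LinearMap.toMatrix b b ((h : V ≃ₗ[K] V) : V →ₗ[K] V) =
      (L.map Matrix.TransvectionStruct.toMatrix).prod := by
  induction L with
  | nil => exact ⟨1, H.one_mem, LinearMap.toMatrix_one b⟩
  | cons t L ih =>
    obtain ⟨h, hh, e⟩ := ih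
    refine ⟨rootElt b t.i t.j t.c * h, H.mul_mem (hH _ _ t.hij _) hh, ?_⟩
    have e1 : ((((rootElt b t.i t.j t.c * h : SpecialLinearGroup K V)) : V ≃ₗ[K] V) : V →ₗ[K] V) =
        (((rootElt b t.i t.j t.c : SpecialLinearGroup K V) : V ≃ₗ[K] V) : V →ₗ[K] V) ∘ₗ
          ((h : V ≃ₗ[K] V) : V →ₗ[K] V) := rfl
    rw [e1, LinearMap.toMatrix_comp b b b, e, List.map_cons, List.prod_cons]
    congr 1
    ext i j
    rw [LinearMap.toMatrix_apply]
    have : (((rootElt b t.i t.j t.c : SpecialLinearGroup K V) : V ≃ₗ[K] V) : V →ₗ[K] V) (b j) =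
      _ := rootElt_smul b t.hij t.c (b j)
    rw [this]
    simp only [Matrix.TransvectionStruct.toMatrix, Matrix.transvection, Matrix.add_apply,
      Matrix.one_apply, Matrix.single_apply, map_add, map_smul, Basis.repr_self, Finsupp.add_apply,
      Finsupp.smul_apply, Finsupp.single_apply, smul_eq_mul]
    grind

theorem eq_top_of_rootElt_mem [Nonempty ι] {H : Subgroup (SpecialLinearGroup K V)}
    (hH : ∀ i j, i ≠ j → ∀ a, rootElt b i j a ∈ H) : H = ⊤ := by
  refine (Subgroup.eq_top_iff' H).2 fun g => ?_
  obtain ⟨L, L', D, e⟩ := Matrix.Pivot.exists_list_transvec_mul_diagonal_mul_list_transvec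
    (LinearMap.toMatrix b b ((g : V ≃ₗ[K] V) : V →ₗ[K] V))
  obtain ⟨h, hh, eh⟩ := exists_mem_toMatrix_eq_prod b hH L
  obtain ⟨h', hh', eh'⟩ := exists_mem_toMatrix_eq_prod b hH L'
  have hN : h⁻¹ * g * h'⁻¹ ∈ H := by
    refine mem_of_diagonal b hH (Classical.arbitrary ι) (Finset.univ.erase (Classical.arbitrary ι))
      (by simp) _ D (fun i => ?_) (fun i hi hi' => absurd (by simpa using hi) hi')
    rw [mul_smul, mul_smul, inv_smul_eq_iff]
    have e1 : ((g : V ≃ₗ[K] V) : V →ₗ[K] V) = ((h : V ≃ₗ[K] V) : V →ₗ[K] V) ∘ₗ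
        (Matrix.toLin b b (Matrix.diagonal D)) ∘ₗ ((h' : V ≃ₗ[K] V) : V →ₗ[K] V) := by
      apply (LinearMap.toMatrix b b).injective
      rw [LinearMap.toMatrix_comp b b b, LinearMap.toMatrix_comp b b b, eh, eh',
        LinearMap.toMatrix_toLin, e, Matrix.mul_assoc]
    have e2 := LinearMap.congr_fun e1 (h'⁻¹ • b i)
    change g • h'⁻¹ • b i = h • (Matrix.toLin b b (Matrix.diagonal D)) (h' • h'⁻¹ • b i) at e2
    rw [e2, smul_inv_smul, Matrix.toLin_self]
    simp [Matrix.diagonal_apply]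
  simpa [mul_assoc] using H.mul_mem (H.mul_mem hh hN) hh'

/-- `SL(V)` is generated by the root elements `1 + E_{0j}`, `1 + E_{j0}` and `1 + c E_{01}`,
where `c` is a generator of the multiplicative group of the field. -/
theorem eq_top_of_star_mem {H : Subgroup (SpecialLinearGroup K V)} {i₀ i₁ i₂ : ι}
    (h01 : i₀ ≠ i₁) (h02 : i₀ ≠ i₂) (h12 : i₁ ≠ i₂) {c : K}
    (hc : ∀ a : K, a ≠ 0 → ∃ n : ℕ, c ^ n = a)
    (hr : ∀ j, j ≠ i₀ → rootElt b i₀ j 1 ∈ H) (hl : ∀ j, j ≠ i₀ → rootElt b j i₀ 1 ∈ H)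
    (hcm : rootElt b i₀ i₁ c ∈ H) : H = ⊤ := by
  have : Nonempty ι := ⟨i₀⟩
  have hmul : ∀ i j k, i ≠ j → j ≠ k → i ≠ k → ∀ a a' : K, rootElt b i j a ∈ H →
      rootElt b j k a' ∈ H → rootElt b i k (a * a') ∈ H := by
    intro i j k hij hjk hik a a' h h'
    rw [rootElt_mul b hij hjk hik]
    exact H.mul_mem (H.inv_mem h') (H.mul_mem (H.mul_mem h h') (H.inv_mem h))
  have h1 : ∀ i j, i ≠ j → rootElt b i j 1 ∈ H := by
    intro i j hij
    by_cases hi : i = i₀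
    · exact hi ▸ hr j (hi ▸ hij.symm)
    by_cases hj : j = i₀
    · exact hj ▸ hl i hi
    simpa using hmul i i₀ j hi (Ne.symm hj) hij 1 1 (hl i hi) (hr j hj)
  have hall : ∀ a, rootElt b i₀ i₁ a ∈ H → ∀ i j, i ≠ j → rootElt b i j a ∈ H := by
    intro a ha
    have hA : ∀ j, j ≠ i₀ → rootElt b i₀ j a ∈ H := by
      intro j hj
      by_cases hj1 : j = i₁
      · exact hj1 ▸ ha
      · simpa using hmul i₀ i₁ j h01 (Ne.symm hj1) hj.symm a 1 ha (h1 _ _ (Ne.symm hj1))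
    have hB : ∀ i j, i ≠ i₀ → j ≠ i₀ → i ≠ j → rootElt b i j a ∈ H := by
      intro i j hi hj hij
      simpa using hmul i i₀ j hi hj.symm hij 1 a (hl i hi) (hA j hj)
    intro i j hij
    by_cases hi : i = i₀
    · exact hi ▸ hA j (hi ▸ hij.symm)
    by_cases hj : j = i₀
    · subst hj
      obtain ⟨k, hk, hki⟩ : ∃ k, k ≠ j ∧ k ≠ i := by
        by_cases h : i = i₁
        · exact ⟨i₂, h02.symm, h ▸ h12.symm⟩
        · exact ⟨i₁, h01.symm, Ne.symm h⟩
      simpa using hmul i k j hki.symm hk hij a 1 (hB i k hi hk hki.symm) (hl k hk)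
    · exact hB i j hi hj hij
  -- `c ^ (n + 1)` arises as the commutator parameter of `c ^ n` at `(i₀, i₂)` and `c` at `(i₂,
  -- i₁)`; this is where a third index is needed.
  have hpow : ∀ n : ℕ, rootElt b i₀ i₁ (c ^ n) ∈ H := by
    intro n
    induction n with
    | zero => simpa using hr i₁ h01.symm
    | succ n ih =>
      rw [pow_succ]
      exact hmul i₀ i₂ i₁ h02 h12.symm h01 _ _ (hall _ ih _ _ h02) (hall _ hcm _ _ h12.symm)
  refine eq_top_of_rootElt_mem b fun i j hij a => ?_
  by_cases ha : a = 0
  · simp [ha, H.one_mem]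
  · obtain ⟨n, rfl⟩ := hc a ha
    exact hall _ (hpow n) i j hij

/-- Two frames are related by an element of `SL(V)`. -/
theorem exists_SL_frame [Nonempty ι] {v : ι → V} {f : ι → Dual K V}
    (h0 : ∀ i j, i ≠ j → f j (v i) = 0) (h1 : ∀ i, f i (v i) ≠ 0) :
    ∃ s : SpecialLinearGroup K V, ∀ i, ∃ c : K, c ≠ 0 ∧ s • b i = c • v i := by
  have hli : LinearIndependent K v := by
    rw [Fintype.linearIndependent_iff]
    intro g hg i
    have := congrArg (f i) hg
    rw [map_sum, Finset.sum_eq_single i] at this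
    · simpa [h1 i] using this
    · intro j _ hj
      simp [h0 j i hj]
    · simp
  let b' := basisOfLinearIndependentOfCardEqFinrank hli (finrank_eq_card_basis b).symm
  have hb' : (b' : ι → V) = v := coe_basisOfLinearIndependentOfCardEqFinrank _ _
  have hdet : b.det v ≠ 0 := by
    rw [← hb']
    exact (b.isUnit_det b').ne_zero
  let i₀ : ι := Classical.arbitrary ι
  -- Rescaling a single vector by the inverse determinant brings the map into `SL(V)`.
  let w : ι → K := fun i => if i = i₀ then (b.det v)⁻¹ else 1
  have hw : ∀ i, w i ≠ 0 := by
    intro i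
    simp only [w]
    split_ifs
    · exact inv_ne_zero hdet
    · exact one_ne_zero
  let L : V →ₗ[K] V := b.constr K (fun i => w i • v i)
  have hL : ∀ i, L (b i) = w i • v i := fun i => b.constr_basis K _ i
  have hLdet : LinearMap.det L = 1 := by
    have e := b.det_comp L b
    rw [b.det_self, mul_one] at e
    rw [← e]
    have : (L ∘ b : ι → V) = fun i => w i • v i := funext hL
    rw [this, AlternatingMap.map_smul_univ]
    simp [w, hdet]
  have hu : IsUnit (LinearMap.det L) := by rw [hLdet]; exact isUnit_one
  refine ⟨⟨LinearMap.equivOfDetNeZero L hu.ne_zero, ?_⟩, fun i => ⟨w i, hw i, ?_⟩⟩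
  · rw [← Units.val_inj, LinearEquiv.coe_det]
    exact hLdet
  · exact hL i

end RootElements

/-! ### Combinatorics of the off-diagonal grid -/

/-- If two cells of a row are `P`-related, a third cell in the column of one of them cannot be
`P`-related to it: by transitivity it would be related to a cell sharing neither its row nor its
column. So that column is an `H`-class, and the same argument returns from columns to rows. The type
found at one cell then spreads over the grid. -/
theorem rook_dichotomy {ι X : Type*} {P H : X → X → Prop} (hP : Equivalence P)
    (hH : Equivalence H) {x : ι → ι → X} (h3 : ∀ i j : ι, ∃ l, l ≠ i ∧ l ≠ j)
    (hR : ∀ i j k l, i ≠ j → k ≠ l → (P (x i j) (x k l) ∨ H (x i j) (x k l) ↔ i = k ∨ j = l)) :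
    (∀ i j, i ≠ j → (∀ k, i ≠ k → P (x i j) (x i k)) ∧ ∀ k, k ≠ j → H (x i j) (x k j)) ∨
    (∀ i j, i ≠ j → (∀ k, i ≠ k → H (x i j) (x i k)) ∧ ∀ k, k ≠ j → P (x i j) (x k j)) := by
  have hcell : ∀ {P H : X → X → Prop}, Equivalence P → Equivalence H →
      (∀ i j k l, i ≠ j → k ≠ l → (P (x i j) (x k l) ∨ H (x i j) (x k l) ↔ i = k ∨ j = l)) →
      ∀ i j k, i ≠ j → i ≠ k → j ≠ k → P (x i j) (x i k) →
      ∀ i j, i ≠ j → (∀ k, i ≠ k → P (x i j) (x i k)) ∧ ∀ k, k ≠ j → H (x i j) (x k j) := by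
    intro P H hP hH hR
    have hcol : ∀ i j k, i ≠ j → i ≠ k → j ≠ k → P (x i j) (x i k) →
        ∀ l, l ≠ i → l ≠ j → H (x i j) (x l j) := by
      intro i j k hij hik hjk h l hl hlj
      refine ((hR i j l j hij hlj).2 (Or.inr rfl)).resolve_left fun h' => ?_
      have := (hR i k l j hik hlj).1 (Or.inl (hP.trans (hP.symm h) h'))
      grind
    have hrow : ∀ i j l, i ≠ j → l ≠ i → l ≠ j → H (x i j) (x l j) →
        ∀ k, i ≠ k → j ≠ k → P (x i j) (x i k) := by
      intro i j l hij hl hlj h k hik hjk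
      refine ((hR i j i k hij hik).2 (Or.inl rfl)).resolve_right fun h' => ?_
      have := (hR i k l j hik hlj).1 (Or.inr (hH.trans (hH.symm h') h))
      grind
    have hcell : ∀ i j, i ≠ j → (∃ k, i ≠ k ∧ j ≠ k ∧ P (x i j) (x i k)) →
        (∀ k, i ≠ k → P (x i j) (x i k)) ∧ ∀ k, k ≠ j → H (x i j) (x k j) := by
      rintro i j hij ⟨k, hik, hjk, h⟩
      obtain ⟨l, hl, hlj⟩ := h3 i j
      have h1 := hcol i j k hij hik hjk h
      refine ⟨fun k' hk' => ?_, fun k' hk' => ?_⟩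
      · by_cases e : j = k'
        · exact e ▸ hP.refl _
        · exact hrow i j l hij hl hlj (h1 l hl hlj) k' hk' e
      · by_cases e : k' = i
        · exact e ▸ hH.refl _
        · exact h1 k' e hk'
    have hmoveR : ∀ i j k, i ≠ j → i ≠ k → (∃ k, i ≠ k ∧ j ≠ k ∧ P (x i j) (x i k)) →
        ∃ l, i ≠ l ∧ k ≠ l ∧ P (x i k) (x i l) := by
      intro i j k hij hik h
      by_cases e : j = k
      · exact e ▸ h
      · exact ⟨j, hij, Ne.symm e, hP.symm ((hcell i j hij h).1 k hik)⟩
    have hmoveC : ∀ i j k, i ≠ j → k ≠ j → (∃ k, i ≠ k ∧ j ≠ k ∧ P (x i j) (x i k)) →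
        ∃ l, k ≠ l ∧ j ≠ l ∧ P (x k j) (x k l) := by
      intro i j k hij hkj h
      by_cases e : i = k
      · exact e ▸ h
      · obtain ⟨l, hl, hlj⟩ := h3 k j
        exact ⟨l, hl.symm, hlj.symm, hrow k j i hkj e hij
          (hH.symm ((hcell i j hij h).2 k hkj)) l hl.symm hlj.symm⟩
    intro i j k hij hik hjk h i' j' hij'
    refine hcell i' j' hij' ?_
    have h0 : ∃ k, i ≠ k ∧ j ≠ k ∧ P (x i j) (x i k) := ⟨k, hik, hjk, h⟩
    -- The cell `(i, j')` would lie on the diagonal, so the path to `(i', j')` makes a detour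
    -- through a third column.
    by_cases e : i = j'
    · obtain ⟨c, hc, hc'⟩ := h3 i i'
      exact hmoveR i' c j' hc'.symm hij' (hmoveC i c i' hc.symm hc'.symm
        (hmoveR i j c hij hc.symm h0))
    · exact hmoveC i j' i' e hij' (hmoveR i j j' hij e h0)
  by_cases hne : ∃ i j k : ι, i ≠ j ∧ i ≠ k ∧ j ≠ k
  · obtain ⟨i, j, k, hij, hik, hjk⟩ := hne
    rcases (hR i j i k hij hik).2 (Or.inl rfl) with h | h
    · exact Or.inl (hcell hP hH hR i j k hij hik hjk h)
    · refine Or.inr (hcell hH hP (fun i j k l h h' => ?_) i j k hij hik hjk h)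
      rw [or_comm]
      exact hR i j k l h h'
  · refine Or.inl fun i j hij => ?_
    obtain ⟨l, hl, hl'⟩ := h3 i j
    exact absurd ⟨i, j, l, hij, hl.symm, hl'.symm⟩ hne

/-- A homomorphism from `SL(V)` onto a normal subgroup of `G` with trivial centralizer,
whose kernel is central and has no nontrivial `p`-elements. -/
structure IsCentralEmbedding {K V G : Type*} [Field K] [AddCommGroup V] [Module K V] [Group G]
    (p : ℕ) (ρ : SpecialLinearGroup K V →* G) : Prop where
  normal : ρ.range.Normal
  ker_le : ρ.ker ≤ Subgroup.center (SpecialLinearGroup K V)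
  ker_pow : ∀ z ∈ ρ.ker, ∀ k : ℕ, z ^ p ^ k = 1 → z = 1
  centralizer : ∀ g, (∀ s, Commute g (ρ s)) → g = 1

/-- A flag: a nonzero vector `v` and a nonzero linear form `f` with `f v = 0`. -/
def IsFlag {K V : Type*} [Field K] [AddCommGroup V] [Module K V] (t : V × Dual K V) : Prop :=
  t.1 ≠ 0 ∧ t.2 ≠ 0 ∧ t.2 t.1 = 0

/-- Two flags have the same point. -/
def SamePoint {K V : Type*} [Field K] [AddCommGroup V] [Module K V] (s t : V × Dual K V) : Prop :=
  Submodule.span K {s.1} = Submodule.span K {t.1}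

/-- Two flags have the same hyperplane. -/
def SameHyperplane {K V : Type*} [Field K] [AddCommGroup V] [Module K V]
    (s t : V × Dual K V) : Prop :=
  Submodule.span K {s.2} = Submodule.span K {t.2}

/-! ### The index of the image of `SL(V)` -/

section IndexBound

variable {K V G : Type*} [Field K] [Finite K] [AddCommGroup V] [Module K V] [FiniteDimensional K V]
  [Group G] {p : ℕ} [Fact p.Prime] [CharP K p] {ρ : SpecialLinearGroup K V →* G}

theorem samePoint_equivalence : Equivalence (SamePoint (K := K) (V := V)) :=
  ⟨fun _ => rfl, fun h => h.symm, fun h h' => h.trans h'⟩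

theorem sameHyperplane_equivalence : Equivalence (SameHyperplane (K := K) (V := V)) :=
  ⟨fun _ => rfl, fun h => h.symm, fun h h' => h.trans h'⟩

theorem span_eq_of_mem_span {M : Type*} [AddCommGroup M] [Module K M] {x y : M} (hx : x ≠ 0)
    (h : x ∈ Submodule.span K {y}) : Submodule.span K {x} = Submodule.span K {y} := by
  obtain ⟨a, rfl⟩ := Submodule.mem_span_singleton.1 h
  have ha : a ≠ 0 := by rintro rfl; simp at hx
  exact Submodule.span_singleton_smul_eq (IsUnit.mk0 a ha) y

theorem exists_smul_of_span_eq {M : Type*} [AddCommGroup M] [Module K M] {x y : M} (hx : x ≠ 0)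
    (h : Submodule.span K {x} = Submodule.span K {y}) : ∃ a : K, a ≠ 0 ∧ x = a • y := by
  have : x ∈ Submodule.span K {y} := h ▸ Submodule.mem_span_singleton_self x
  obtain ⟨a, rfl⟩ := Submodule.mem_span_singleton.1 this
  exact ⟨a, by rintro rfl; simp at hx, rfl⟩

theorem exists_ne_zero_of_span_ne {f g : Dual K V} (hg : g ≠ 0)
    (h : Submodule.span K {g} ≠ Submodule.span K {f}) : ∃ x, f x = 0 ∧ g x ≠ 0 := by
  by_contra! H
  exact h (span_eq_of_mem_span hg (mem_span_of_ker_le H))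

namespace IsCentralEmbedding

/-- The quotient `x y⁻¹` is central, so its `p`-th power is `x ^ p y ^ (-p) = 1`, and the kernel has
no nontrivial `p`-elements. -/
theorem eq_of_map_eq (hρ : IsCentralEmbedding p ρ) {x y : SpecialLinearGroup K V}
    (h : ρ x = ρ y) (hx : x ^ p = 1) (hy : y ^ p = 1) : x = y := by
  have hz : x * y⁻¹ ∈ ρ.ker := by rw [MonoidHom.mem_ker, map_mul, map_inv, h, mul_inv_cancel]
  have hc : Commute (x * y⁻¹) y := (Subgroup.mem_center_iff.1 (hρ.ker_le hz) y).symm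
  have hxy : x = x * y⁻¹ * y := by group
  have h1 : (x * y⁻¹) ^ p = 1 := by
    rw [hxy, hc.mul_pow, hy, mul_one] at hx
    exact hx
  have := hρ.ker_pow _ hz 1 (by rwa [pow_one])
  rwa [mul_inv_eq_one] at this

theorem map_tv_ne_one (hρ : IsCentralEmbedding p ρ) {t : V × Dual K V} (ht : IsFlag t) :
    ρ (tv t.1 t.2) ≠ 1 := fun h =>
  tv_ne_one ht.2.2 ht.1 ht.2.1
    (hρ.eq_of_map_eq (h.trans ρ.map_one.symm) (tv_pow_char p ht.2.2) (one_pow p))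

/-- Conjugation by any element of `G` permutes the images of the transvections. -/
theorem conj_tv (hρ : IsCentralEmbedding p ρ) (hd : 2 ≤ finrank K V) (g : G)
    {t : V × Dual K V} (ht : IsFlag t) :
    ∃ t' : V × Dual K V, IsFlag t' ∧ g * ρ (tv t.1 t.2) * g⁻¹ = ρ (tv t'.1 t'.2) := by
  have : Finite V := Module.finite_of_finite K
  have : Finite (V ≃ₗ[K] V) := Finite.of_injective _ (DFunLike.coe_injective (F := V ≃ₗ[K] V))
  have := hρ.normal
  obtain ⟨P, hP, hPc⟩ := exists_sylow_tv_mem_center p hd ht.1 ht.2.1 ht.2.2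
  have hs := ρ.rangeRestrict_surjective
  obtain ⟨Q, hQ⟩ := Sylow.mapSurjective_surjective hs p
    ((MulAut.conjNormal g : MulAut ρ.range) • P.mapSurjective hs)
  have hmem : ∀ x : SpecialLinearGroup K V, (∃ y ∈ P, g * ρ y * g⁻¹ = ρ x) ↔
      ∃ y ∈ Q, ρ y = ρ x := by
    intro x
    have h1 : ρ.rangeRestrict x ∈ Q.mapSurjective hs ↔ ∃ y ∈ Q, ρ y = ρ x := by
      change ρ.rangeRestrict x ∈ (Q.1.map ρ.rangeRestrict) ↔ _
      simp only [Subgroup.mem_map, Subtype.ext_iff, MonoidHom.coe_rangeRestrict]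
      rfl
    rw [← h1, hQ]
    change _ ↔ ρ.rangeRestrict x ∈
      (P.1.map ρ.rangeRestrict).map (MulAut.conjNormal g : MulAut ρ.range).toMonoidHom
    simp only [Subgroup.mem_map]
    constructor
    · rintro ⟨y, hy, e⟩
      exact ⟨_, ⟨y, hy, rfl⟩, Subtype.ext (by simpa using e)⟩
    · rintro ⟨_, ⟨y, hy, rfl⟩, e⟩
      exact ⟨y, hy, by simpa using congrArg Subtype.val e⟩
  obtain ⟨w, hw⟩ : ∃ w, ρ w = g * ρ (tv t.1 t.2) * g⁻¹ :=
    hρ.normal.conj_mem _ ⟨_, rfl⟩ g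
  obtain ⟨z, hzQ, hz⟩ := (hmem w).1 ⟨_, hP, hw.symm⟩
  have hzc : ∀ x ∈ Q, Commute z x := by
    intro x hx
    obtain ⟨y, hy, hyx⟩ := (hmem x).2 ⟨x, hx, rfl⟩
    have hc : Commute (ρ z) (ρ x) := by
      rw [hz, hw, ← hyx]
      exact ((hPc y hy).map ρ).conj g
    -- The commutator lies both in the kernel and in the `p`-group `Q`, hence is trivial: centrality
    -- lifts from the image of `Q` to `Q`.
    have hk : z * x * z⁻¹ * x⁻¹ ∈ ρ.ker := by
      rw [MonoidHom.mem_ker]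
      simp only [map_mul, map_inv]
      rw [hc.eq]
      group
    have hm : z * x * z⁻¹ * x⁻¹ ∈ Q :=
      Q.1.mul_mem (Q.1.mul_mem (Q.1.mul_mem hzQ hx) (Q.1.inv_mem hzQ)) (Q.1.inv_mem hx)
    obtain ⟨k, hk'⟩ := Q.2 ⟨_, hm⟩
    have := hρ.ker_pow _ hk k (congrArg Subtype.val hk')
    rw [mul_inv_eq_one, mul_inv_eq_iff_eq_mul] at this
    exact this
  obtain ⟨v, f, hv, hf, hvf, hzz⟩ := exists_sylow_center p hd Q
  obtain ⟨a, ha⟩ := (hzz z).1 ⟨hzQ, hzc⟩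
  have ha0 : a ≠ 0 := by
    rintro rfl
    rw [zero_smul, tv_zero_right] at ha
    rw [ha, hw, map_one] at hz
    apply hρ.map_tv_ne_one ht
    have := hz.symm
    rwa [mul_inv_eq_one, mul_eq_left] at this
  exact ⟨(v, a • f), ⟨hv, smul_ne_zero ha0 hf, by simp [hvf]⟩, by rw [← hw, ← hz, ha]⟩

theorem map_commute_iff (hρ : IsCentralEmbedding p ρ) {s t : V × Dual K V} (hs : IsFlag s)
    (ht : IsFlag t) :
    Commute (ρ (tv s.1 s.2)) (ρ (tv t.1 t.2)) ↔ s.2 t.1 = 0 ∧ t.2 s.1 = 0 := by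
  rw [← tv_commute_iff hs.2.2 ht.2.2 hs.1 ht.1 hs.2.1 ht.2.1]
  refine ⟨fun h => ?_, fun h => h.map ρ⟩
  have h1 : ρ (tv s.1 s.2 * tv t.1 t.2 * (tv s.1 s.2)⁻¹) = ρ (tv t.1 t.2) := by
    rw [map_mul, map_mul, map_inv, h.eq]
    group
  have := hρ.eq_of_map_eq h1 (by rw [conj_pow, tv_pow_char p ht.2.2]; group)
    (tv_pow_char p ht.2.2)
  rwa [mul_inv_eq_iff_eq_mul] at this

/-- Two elements commute and their product is trivial or a transvection. -/
def Rel (ρ : SpecialLinearGroup K V →* G) (x y : G) : Prop :=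
  Commute x y ∧ (x * y = 1 ∨ ∃ t : V × Dual K V, IsFlag t ∧ x * y = ρ (tv t.1 t.2))

theorem rel_conj (hρ : IsCentralEmbedding p ρ) (hd : 2 ≤ finrank K V) (g : G) {x y : G}
    (h : Rel ρ x y) : Rel ρ (g * x * g⁻¹) (g * y * g⁻¹) := by
  refine ⟨h.1.conj g, ?_⟩
  have e : g * x * g⁻¹ * (g * y * g⁻¹) = g * (x * y) * g⁻¹ := by group
  rw [e]
  rcases h.2 with h | ⟨t, ht, h⟩
  · left; rw [h]; group
  · right
    rw [h]
    exact hρ.conj_tv hd g ht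

theorem rel_conj_iff (hρ : IsCentralEmbedding p ρ) (hd : 2 ≤ finrank K V) (g : G) {x y : G} :
    Rel ρ (g * x * g⁻¹) (g * y * g⁻¹) ↔ Rel ρ x y := by
  refine ⟨fun h => ?_, hρ.rel_conj hd g⟩
  have := hρ.rel_conj hd g⁻¹ h
  have e : ∀ x, g⁻¹ * (g * x * g⁻¹) * g⁻¹⁻¹ = x := fun x => by group
  rwa [e, e] at this

/-- The product of two commuting transvections moves `x` by `s.2 x • s.1 + t.2 x • t.1`. If it is
trivial or a transvection, these displacements lie on one line, which is impossible when both the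
points and the hyperplanes differ. -/
theorem rel_iff (hρ : IsCentralEmbedding p ρ) {s t : V × Dual K V} (hs : IsFlag s)
    (ht : IsFlag t) :
    Rel ρ (ρ (tv s.1 s.2)) (ρ (tv t.1 t.2)) ↔ SamePoint s t ∨ SameHyperplane s t := by
  constructor
  · rintro ⟨hc, h⟩
    have hc' := (hρ.map_commute_iff hs ht).1 hc
    have hcc := (tv_commute_iff hs.2.2 ht.2.2 hs.1 ht.1 hs.2.1 ht.2.1).2 hc'
    have hp : (tv s.1 s.2 * tv t.1 t.2) ^ p = 1 := by
      rw [hcc.mul_pow, tv_pow_char p hs.2.2, tv_pow_char p ht.2.2, mul_one]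
    obtain ⟨w, hw⟩ : ∃ w : V, ∀ x, s.2 x • s.1 + t.2 x • t.1 ∈ Submodule.span K {w} := by
      have key : ∀ x, (tv s.1 s.2 * tv t.1 t.2) • x = x + (s.2 x • s.1 + t.2 x • t.1) := by
        intro x
        rw [mul_smul, tv_apply ht.2.2, tv_apply hs.2.2]
        simp [hc'.1]
        abel
      rcases h with h | ⟨u, hu, h⟩
      · refine ⟨0, fun x => ?_⟩
        have e := hρ.eq_of_map_eq ((map_mul ρ _ _).trans (h.trans ρ.map_one.symm)) hp (one_pow p)
        have := key x
        rw [e, one_smul] at this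
        rw [left_eq_add.1 this]
        exact Submodule.zero_mem _
      · refine ⟨u.1, fun x => ?_⟩
        have e := hρ.eq_of_map_eq ((map_mul ρ _ _).trans h) hp (tv_pow_char p hu.2.2)
        have := key x
        rw [e, tv_apply hu.2.2] at this
        rw [← add_left_cancel this]
        exact Submodule.smul_mem _ _ (Submodule.mem_span_singleton_self _)
    by_contra! hne
    obtain ⟨x, hx, hx'⟩ := exists_ne_zero_of_span_ne ht.2.1 (Ne.symm hne.2)
    obtain ⟨y, hy, hy'⟩ := exists_ne_zero_of_span_ne hs.2.1 hne.2
    have h1 := hw x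
    rw [hx, zero_smul, zero_add, Submodule.smul_mem_iff _ hx'] at h1
    have h2 := hw y
    rw [hy, zero_smul, add_zero, Submodule.smul_mem_iff _ hy'] at h2
    exact hne.1 ((span_eq_of_mem_span hs.1 h2).trans (span_eq_of_mem_span ht.1 h1).symm)
  · rintro (h | h)
    · obtain ⟨a, ha, e⟩ := exists_smul_of_span_eq ht.1 h.symm
      have h1 : s.2 t.1 = 0 := by rw [e]; simp [hs.2.2]
      have h2 : t.2 s.1 = 0 := by
        have := ht.2.2
        rw [e, map_smul, smul_eq_mul] at this
        exact (mul_eq_zero.1 this).resolve_left ha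
      refine ⟨(hρ.map_commute_iff hs ht).2 ⟨h1, h2⟩, ?_⟩
      rw [← map_mul, e, tv_smul _ h2, tv_mul_left hs.2.2 (by simp [h2])]
      by_cases h0 : s.2 + a • t.2 = 0
      · left; rw [h0, tv_zero_right, map_one]
      · exact Or.inr ⟨(s.1, s.2 + a • t.2), ⟨hs.1, h0, by simp [hs.2.2, h2]⟩, rfl⟩
    · obtain ⟨a, ha, e⟩ := exists_smul_of_span_eq ht.2.1 h.symm
      have h1 : t.2 s.1 = 0 := by rw [e]; simp [hs.2.2]
      have h2 : s.2 t.1 = 0 := by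
        have := ht.2.2
        rw [e, LinearMap.smul_apply, smul_eq_mul] at this
        exact (mul_eq_zero.1 this).resolve_left ha
      refine ⟨(hρ.map_commute_iff hs ht).2 ⟨h2, h1⟩, ?_⟩
      rw [← map_mul, e, ← tv_smul _ h2, tv_mul_right hs.2.2 (by simp [h2])]
      by_cases h0 : s.1 + a • t.1 = 0
      · left; rw [h0, tv_zero_left, map_one]
      · exact Or.inr ⟨(s.1 + a • t.1, s.2), ⟨h0, hs.2.1, by simp [hs.2.2, h2]⟩, rfl⟩

variable {ι : Type*} [Fintype ι] [DecidableEq ι] (b : Basis ι K V)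

theorem rootElt_flag {i j : ι} (h : i ≠ j) {a : K} (ha : a ≠ 0) :
    IsFlag (b i, a • b.coord j) := by
  refine ⟨b.ne_zero i, fun h0 => ?_, rootElt_cond b h a⟩
  have := LinearMap.congr_fun h0 (b j)
  simp [ha] at this

/-- The root element with the two indices possibly exchanged. -/
noncomputable def signedRootElt (ε : Bool) (i j : ι) (a : K) : SpecialLinearGroup K V :=
  if ε then rootElt b i j a else rootElt b j i a

theorem span_coord_eq_iff {i j : ι} :
    Submodule.span K {b.coord i} = Submodule.span K {b.coord j} ↔ i = j := by
  refine ⟨fun h => ?_, fun h => h ▸ rfl⟩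
  by_contra hij
  have hne : b.coord i ≠ 0 := fun h0 => by simpa using LinearMap.congr_fun h0 (b i)
  obtain ⟨a, ha, e⟩ := exists_smul_of_span_eq hne h
  have := LinearMap.congr_fun e (b i)
  simp [hij] at this

theorem span_basis_eq_iff {i j : ι} :
    Submodule.span K {b i} = Submodule.span K {b j} ↔ i = j := by
  refine ⟨fun h => ?_, fun h => h ▸ rfl⟩
  by_contra hij
  obtain ⟨a, ha, e⟩ := exists_smul_of_span_eq (b.ne_zero i) h
  have := congrArg (b.coord i) e
  simp [Ne.symm hij] at this

theorem contra_smul (g : SpecialLinearGroup K V) (a : K) (f : Dual K V) :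
    contra g (a • f) = a • contra g f := rfl

/-- Up to the image of `SL(V)`, conjugation by an element of `G` preserves the root subgroups,
or exchanges opposite root subgroups. -/
theorem exists_conj_rootElt (hρ : IsCentralEmbedding p ρ) (hd : 2 ≤ finrank K V) [Nonempty ι]
    (h3 : ∀ i j : ι, ∃ l, l ≠ i ∧ l ≠ j) (g : G) :
    ∃ (s : SpecialLinearGroup K V) (ε : Bool), ∀ i j, i ≠ j → ∀ c : K, c ≠ 0 →
      ∃ a : K, a ≠ 0 ∧ ρ s⁻¹ * g * ρ (rootElt b i j c) * (ρ s⁻¹ * g)⁻¹ =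
        ρ (signedRootElt b ε i j a) := by
  have hex : ∀ i j (c : K), ∃ t : V × Dual K V, i ≠ j → c ≠ 0 →
      IsFlag t ∧ g * ρ (rootElt b i j c) * g⁻¹ = ρ (tv t.1 t.2) := by
    intro i j c
    by_cases h : i ≠ j ∧ c ≠ 0
    · obtain ⟨t, ht, e⟩ := hρ.conj_tv hd g (rootElt_flag b h.1 h.2)
      exact ⟨t, fun _ _ => ⟨ht, e⟩⟩
    · exact ⟨0, fun h1 h2 => absurd ⟨h1, h2⟩ h⟩
  choose y hy using hex
  have hflag := fun i j c hij hc => (hy i j c hij hc).1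
  have hconj := fun i j c hij hc => (hy i j c hij hc).2
  have hrel : ∀ i j k l (c c' : K), i ≠ j → k ≠ l → c ≠ 0 → c' ≠ 0 →
      (SamePoint (y i j c) (y k l c') ∨ SameHyperplane (y i j c) (y k l c') ↔ i = k ∨ j = l) := by
    intro i j k l c c' hij hkl hc hc'
    rw [← hρ.rel_iff (hflag i j c hij hc) (hflag k l c' hkl hc'), ← hconj i j c hij hc,
      ← hconj k l c' hkl hc', hρ.rel_conj_iff hd g, rootElt, rootElt,
      hρ.rel_iff (rootElt_flag b hij hc) (rootElt_flag b hkl hc'), SamePoint, SameHyperplane,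
      Submodule.span_singleton_smul_eq (IsUnit.mk0 c hc),
      Submodule.span_singleton_smul_eq (IsUnit.mk0 c' hc'), span_basis_eq_iff, span_coord_eq_iff]
  -- Root elements at `(i, j)` and `(j, k)` do not commute, nor do their conjugates. This later
  -- gives `f j (v j) ≠ 0`.
  have hcomm : ∀ i j k, i ≠ j → j ≠ k → i ≠ k →
      ¬ ((y i j 1).2 (y j k 1).1 = 0 ∧ (y j k 1).2 (y i j 1).1 = 0) := by
    intro i j k hij hjk hik h
    have h1 := (hρ.map_commute_iff (hflag i j 1 hij one_ne_zero)
      (hflag j k 1 hjk one_ne_zero)).2 h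
    rw [← hconj i j 1 hij one_ne_zero, ← hconj j k 1 hjk one_ne_zero] at h1
    have h2 := h1.conj g⁻¹
    have e : ∀ x, g⁻¹ * (g * x * g⁻¹) * g⁻¹⁻¹ = x := fun x => by group
    rw [e, e] at h2
    have := ((hρ.map_commute_iff (rootElt_flag b hij one_ne_zero)
      (rootElt_flag b hjk one_ne_zero)).1 h2).1
    simp at this
  have hrook := rook_dichotomy samePoint_equivalence sameHyperplane_equivalence
    (x := fun i j => y i j 1) h3
    (fun i j k l hij hkl => hrel i j k l 1 1 hij hkl one_ne_zero one_ne_zero)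
  choose r hr hr' using h3
  -- The flag for `c` is adjacent to those at `(i, j)`, `(i, k)` and `(k, j)`. Agreeing with the
  -- flag for `1` in only one component would make `(i, k)` and `(k, j)` adjacent.
  have hpar : ∀ i j, i ≠ j → ∀ c : K, c ≠ 0 →
      SamePoint (y i j c) (y i j 1) ∧ SameHyperplane (y i j c) (y i j 1) := by
    intro i j hij c hc
    have hk := hr i j
    have hk' := hr' i j
    set k := r i j
    have h1 := (hrel i j i j c 1 hij hij hc one_ne_zero).2 (Or.inl rfl)
    have h2 := (hrel i j i k c 1 hij hk.symm hc one_ne_zero).2 (Or.inl rfl)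
    have h3 := (hrel i j k j c 1 hij hk' hc one_ne_zero).2 (Or.inr rfl)
    have h4 := fun h => (hrel i k k j 1 1 hk.symm hk' one_ne_zero one_ne_zero).1 h
    have h5 : ¬ (i = k ∨ k = j) := by simp [hk.symm, hk']
    unfold SamePoint SameHyperplane at *
    rcases hrook with h | h
    · have a1 := (h i j hij).1 k hk.symm
      have a2 := (h i j hij).2 k hk'
      grind
    · have a1 := (h i j hij).1 k hk.symm
      have a2 := (h i j hij).2 k hk'
      grind
  have hsame : ∃ (v : ι → V) (f : ι → Dual K V) (ε : Bool),
      ∀ i j, i ≠ j → ∀ c : K, c ≠ 0 →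
        Submodule.span K {(y i j c).1} = Submodule.span K {v (if ε then i else j)} ∧
        Submodule.span K {(y i j c).2} = Submodule.span K {f (if ε then j else i)} := by
    rcases hrook with h | h
    · refine ⟨fun i => (y i (r i i) 1).1, fun j => (y (r j j) j 1).2, true,
        fun i j hij c hc => ⟨?_, ?_⟩⟩
      · exact (hpar i j hij c hc).1.trans ((h i j hij).1 _ (hr i i).symm)
      · exact (hpar i j hij c hc).2.trans ((h i j hij).2 _ (hr j j))
    · refine ⟨fun j => (y (r j j) j 1).1, fun i => (y i (r i i) 1).2, false,
        fun i j hij c hc => ⟨?_, ?_⟩⟩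
      · exact (hpar i j hij c hc).1.trans ((h i j hij).2 _ (hr j j))
      · exact (hpar i j hij c hc).2.trans ((h i j hij).1 _ (hr i i).symm)
  obtain ⟨v, f, ε, hvf⟩ := hsame
  have hv : ∀ i j, i ≠ j → ∀ c : K, c ≠ 0 →
      ∃ a : K, a ≠ 0 ∧ (y i j c).1 = a • v (if ε then i else j) := fun i j hij c hc =>
    exists_smul_of_span_eq (hflag i j c hij hc).1 (hvf i j hij c hc).1
  have hf : ∀ i j, i ≠ j → ∀ c : K, c ≠ 0 →
      ∃ a : K, a ≠ 0 ∧ (y i j c).2 = a • f (if ε then j else i) := fun i j hij c hc =>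
    exists_smul_of_span_eq (hflag i j c hij hc).2.1 (hvf i j hij c hc).2
  have hf0 : ∀ i j, i ≠ j → f j (v i) = 0 := by
    intro i j hij
    have hij' : (if ε then i else j) ≠ (if ε then j else i) := by
      cases ε
      · simpa using hij.symm
      · simpa using hij
    obtain ⟨a, ha, e⟩ := hv _ _ hij' 1 one_ne_zero
    obtain ⟨a', ha', e'⟩ := hf _ _ hij' 1 one_ne_zero
    have := (hflag _ _ 1 hij' one_ne_zero).2.2
    rw [e, e'] at this
    cases ε <;> simpa [ha, ha'] using this
  have hf1 : ∀ j, f j (v j) ≠ 0 := by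
    intro j h0
    have hij : r j j ≠ j := hr j j
    have hk := hr (r j j) j
    have hk' := hr' (r j j) j
    set i := r j j
    set k := r i j
    refine hcomm i j k hij hk'.symm hk.symm ?_
    obtain ⟨a1, ha1, e1⟩ := hv i j hij 1 one_ne_zero
    obtain ⟨a2, ha2, e2⟩ := hf i j hij 1 one_ne_zero
    obtain ⟨a3, ha3, e3⟩ := hv j k hk'.symm 1 one_ne_zero
    obtain ⟨a4, ha4, e4⟩ := hf j k hk'.symm 1 one_ne_zero
    rw [e1, e2, e3, e4]
    have := hf0 i k hk.symm
    have := hf0 k i hk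
    cases ε <;> simp [*]
  -- The image points `v` and hyperplanes `f` form a frame with its dual frame up to scalars, so
  -- `s⁻¹` returns them to the standard ones.
  obtain ⟨s, hs⟩ := exists_SL_frame b hf0 hf1
  refine ⟨s, ε, fun i j hij c hc => ?_⟩
  obtain ⟨a1, ha1, e1⟩ := hv i j hij c hc
  obtain ⟨a2, ha2, e2⟩ := hf i j hij c hc
  have hsv : ∀ i, ∃ c : K, c ≠ 0 ∧ s⁻¹ • v i = c • b i := by
    intro i
    obtain ⟨c, hc, e⟩ := hs i
    refine ⟨c⁻¹, inv_ne_zero hc, ?_⟩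
    rw [inv_smul_eq_iff, SL_smul_smul, e, smul_smul, inv_mul_cancel₀ hc, one_smul]
  have hsf : ∀ j, ∃ c : K, c ≠ 0 ∧ contra s⁻¹ (f j) = c • b.coord j := by
    intro j
    obtain ⟨c, hc, e⟩ := hs j
    refine ⟨c * f j (v j), mul_ne_zero hc (hf1 j), b.ext fun i => ?_⟩
    obtain ⟨c', hc', e'⟩ := hs i
    by_cases hij : i = j
    · subst hij
      simp [e]
    · simp [e', hf0 i j hij, hij]
  have hfin : ρ s⁻¹ * g * ρ (rootElt b i j c) * (ρ s⁻¹ * g)⁻¹ =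
      ρ (tv (s⁻¹ • (y i j c).1) (contra s⁻¹ (y i j c).2)) := by
    rw [← tv_conj _ (hflag i j c hij hc).2.2, map_mul, map_mul, ← hconj i j c hij hc]
    simp only [map_inv, mul_inv_rev, inv_inv]
    group
  obtain ⟨c1, hc1, h1⟩ := hsv (if ε then i else j)
  obtain ⟨c2, hc2, h2⟩ := hsf (if ε then j else i)
  refine ⟨a1 * c1 * (a2 * c2), mul_ne_zero (mul_ne_zero ha1 hc1) (mul_ne_zero ha2 hc2), ?_⟩
  rw [hfin, e1, e2, SL_smul_smul, h1, contra_smul, h2, smul_smul, smul_smul,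
    tv_smul _ (by cases ε <;> simp [hij, hij.symm]), smul_smul]
  cases ε <;> rfl

/-- The elements whose images commute with `g⁻¹ g'` form a subgroup containing the generators of
`eq_top_of_star_mem`; the trivial centralizer then gives `g = g'`. -/
theorem eq_of_conj_eq (hρ : IsCentralEmbedding p ρ) {i₀ i₁ i₂ : ι}
    (h01 : i₀ ≠ i₁) (h02 : i₀ ≠ i₂) (h12 : i₁ ≠ i₂) {c : K}
    (hc : ∀ a : K, a ≠ 0 → ∃ n : ℕ, c ^ n = a) {g g' : G}
    (hr : ∀ j, j ≠ i₀ →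
      g * ρ (rootElt b i₀ j 1) * g⁻¹ = g' * ρ (rootElt b i₀ j 1) * g'⁻¹)
    (hl : ∀ j, j ≠ i₀ →
      g * ρ (rootElt b j i₀ 1) * g⁻¹ = g' * ρ (rootElt b j i₀ 1) * g'⁻¹)
    (hcm : g * ρ (rootElt b i₀ i₁ c) * g⁻¹ = g' * ρ (rootElt b i₀ i₁ c) * g'⁻¹) :
    g = g' := by
  let H : Subgroup (SpecialLinearGroup K V) := (Subgroup.centralizer {g⁻¹ * g'}).comap ρ
  have hH : ∀ t, g * ρ t * g⁻¹ = g' * ρ t * g'⁻¹ → t ∈ H := by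
    intro t ht
    change ρ t ∈ Subgroup.centralizer {g⁻¹ * g'}
    rw [Subgroup.mem_centralizer_singleton_iff]
    calc ρ t * (g⁻¹ * g') = g⁻¹ * (g * ρ t * g⁻¹) * g' := by group
      _ = g⁻¹ * g' * ρ t := by rw [ht]; group
  have htop : H = ⊤ := eq_top_of_star_mem b h01 h02 h12 hc (fun j hj => hH _ (hr j hj))
    (fun j hj => hH _ (hl j hj)) (hH _ hcm)
  have := hρ.centralizer (g⁻¹ * g') fun s => by
    have : s ∈ H := htop ▸ Subgroup.mem_top s
    exact (Subgroup.mem_centralizer_singleton_iff.1 this).symm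
  exact inv_mul_eq_one.1 this

theorem index_range_le (hρ : IsCentralEmbedding p ρ) (hd : 3 ≤ finrank K V) :
    ρ.range.index ≤ 2 * (Nat.card K - 1) ^ (2 * finrank K V - 1) := by
  classical
  let b := finBasis K V
  let i₀ : Fin (finrank K V) := ⟨0, by omega⟩
  let i₁ : Fin (finrank K V) := ⟨1, by omega⟩
  let i₂ : Fin (finrank K V) := ⟨2, by omega⟩
  have h01 : i₀ ≠ i₁ := by simp [i₀, i₁]
  have h02 : i₀ ≠ i₂ := by simp [i₀, i₂]
  have h12 : i₁ ≠ i₂ := by simp [i₁, i₂]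
  have : Nonempty (Fin (finrank K V)) := ⟨i₀⟩
  have h3 : ∀ i j : Fin (finrank K V), ∃ l, l ≠ i ∧ l ≠ j := by
    intro i j
    by_contra! H
    have := H i₀
    have := H i₁
    have := H i₂
    grind
  obtain ⟨c, hc⟩ := IsCyclic.exists_generator (α := Kˣ)
  have hc' : ∀ a : K, a ≠ 0 → ∃ n : ℕ, (c : K) ^ n = a := by
    intro a ha
    obtain ⟨n, hn⟩ := Submonoid.mem_powers_iff _ _ |>.1
      (mem_powers_iff_mem_zpowers.2 (hc (Units.mk0 a ha)))
    exact ⟨n, by simpa using congrArg Units.val hn⟩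
  have hex : ∀ C : G ⧸ ρ.range, ∃ (g : G) (ε : Bool)
      (A : Fin (finrank K V) → Fin (finrank K V) → K → K), (g : G ⧸ ρ.range) = C ∧
      ∀ i j, i ≠ j → ∀ c : K, c ≠ 0 → A i j c ≠ 0 ∧
        g * ρ (rootElt b i j c) * g⁻¹ = ρ (signedRootElt b ε i j (A i j c)) := by
    intro C
    obtain ⟨g, rfl⟩ := QuotientGroup.mk_surjective C
    obtain ⟨s, ε, h⟩ := hρ.exists_conj_rootElt b (by omega) h3 g
    choose! A hA using h
    refine ⟨ρ s⁻¹ * g, ε, A, ?_, hA⟩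
    rw [QuotientGroup.eq]
    have := hρ.normal.conj_mem (ρ s) ⟨s, rfl⟩ g⁻¹
    simpa [mul_assoc] using this
  choose g ε A hg hA using hex
  -- A normalized representative of each coset is recorded by its type and by `(d - 1) + (d - 1) +
  -- 1` nonzero scalars, one for each generator.
  let F : G ⧸ ρ.range → Bool × ({j // j ≠ i₀} → Kˣ) × ({j // j ≠ i₀} → Kˣ) × Kˣ := fun C =>
    (ε C, fun j => Units.mk0 (A C i₀ j 1) (hA C i₀ j j.2.symm 1 one_ne_zero).1,
      fun j => Units.mk0 (A C j i₀ 1) (hA C j i₀ j.2 1 one_ne_zero).1,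
      Units.mk0 (A C i₀ i₁ c) (hA C i₀ i₁ h01 c c.ne_zero).1)
  have hF : Function.Injective F := by
    intro C C' h
    simp only [F, Prod.mk.injEq, funext_iff, Units.ext_iff, Units.val_mk0, Subtype.forall] at h
    obtain ⟨h1, h2, h3, h4⟩ := h
    rw [← hg C, ← hg C']
    congr 1
    refine hρ.eq_of_conj_eq b h01 h02 h12 hc' (fun j hj => ?_) (fun j hj => ?_) ?_
    · rw [(hA C i₀ j hj.symm 1 one_ne_zero).2, (hA C' i₀ j hj.symm 1 one_ne_zero).2, h1, h2 j hj]
    · rw [(hA C j i₀ hj 1 one_ne_zero).2, (hA C' j i₀ hj 1 one_ne_zero).2, h1, h3 j hj]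
    · rw [(hA C i₀ i₁ h01 c c.ne_zero).2, (hA C' i₀ i₁ h01 c c.ne_zero).2, h1, h4]
  have hcard := Nat.card_le_card_of_injective F hF
  have hu : Nat.card Kˣ = Nat.card K - 1 := Nat.card_units K
  have hj : Nat.card {j // j ≠ i₀} = finrank K V - 1 := by simp
  rw [← Subgroup.index] at hcard
  refine hcard.trans (le_of_eq ?_)
  rw [Nat.card_prod, Nat.card_prod, Nat.card_prod, Nat.card_fun, hj, hu]
  simp only [Nat.card_eq_fintype_card, Fintype.card_bool]
  rw [← pow_succ, ← pow_add]
  congr 2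
  omega

end IsCentralEmbedding

end IndexBound

/-! ### A potential for algebras stabilizing small subspaces -/

section Potential

variable {K E : Type*} [Field K] [AddCommGroup E] [Module K E] [FiniteDimensional K E]

/-- The potential `(m + 1) dim Y - dim (𝒜|Y)` of a space `𝒜` of endomorphisms and
a subspace `Y`. -/
noncomputable def potential (m : ℕ) (𝒜 : Submodule K (E →ₗ[K] E)) (Y : Submodule K E) : ℤ :=
  (m + 1) * finrank K Y - finrank K (𝒜.map (LinearMap.lcomp K E Y.subtype))

theorem potential_bot (m : ℕ) (𝒜 : Submodule K (E →ₗ[K] E)) : potential m 𝒜 ⊥ = 0 := by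
  have : Subsingleton ((⊥ : Submodule K E) →ₗ[K] E) :=
    ⟨fun f g => LinearMap.ext fun x => by rw [Subsingleton.elim x 0, map_zero, map_zero]⟩
  rw [potential, Module.finrank_zero_of_subsingleton (M := 𝒜.map _)]
  simp

theorem potential_le_mul (m : ℕ) (𝒜 : Submodule K (E →ₗ[K] E)) (Y : Submodule K E) :
    potential m 𝒜 Y ≤ (m + 1) * finrank K E := by
  have h := Submodule.finrank_le Y
  rw [potential]
  have h2 : ((m : ℤ) + 1) * finrank K Y ≤ (m + 1) * finrank K E := by gcongr
  omega

/-- Let `C` be a complement of `Y ∩ U` in `U`. A map in `𝒜'` restricted to `Y + U` is determined by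
its restrictions to `Y` and to `C`; if the former vanishes, the latter is an arbitrary element of at
most `Hom(C, U)`, of dimension at most `m dim C`. -/
theorem finrank_map_restrict_sup_le {m : ℕ} {𝒜 𝒜' : Submodule K (E →ₗ[K] E)} (h𝒜 : 𝒜' ≤ 𝒜)
    {Y U : Submodule K E} (hU : finrank K U ≤ m) (hst : ∀ A ∈ 𝒜', ∀ u ∈ U, A u ∈ U) :
    finrank K (𝒜'.map (LinearMap.lcomp K E (Y ⊔ U).subtype)) + m * finrank K Y ≤
      finrank K (𝒜.map (LinearMap.lcomp K E Y.subtype)) + m * finrank K (Y ⊔ U : Submodule K E) := by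
  obtain ⟨C₀, hC₀⟩ := Submodule.exists_isCompl (Y.comap U.subtype)
  set C : Submodule K E := C₀.map U.subtype with hC
  have hCU : C ≤ U := Submodule.map_subtype_le U C₀
  have hYC : Y ⊔ C = Y ⊔ U := by
    refine le_antisymm (sup_le_sup_left hCU _) (sup_le le_sup_left fun u hu => ?_)
    have : (⟨u, hu⟩ : U) ∈ Y.comap U.subtype ⊔ C₀ := by rw [hC₀.sup_eq_top]; trivial
    obtain ⟨y, hy, c, hc, e⟩ := Submodule.mem_sup.1 this
    have e' : (y : E) + c = u := congrArg Subtype.val e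
    rw [← e']
    exact Submodule.add_mem_sup hy (Submodule.mem_map_of_mem hc)
  have hYCd : Y ⊓ C = ⊥ := by
    rw [eq_bot_iff]
    rintro _ ⟨hy, c, hc, rfl⟩
    have : c ∈ Y.comap U.subtype ⊓ C₀ := ⟨hy, hc⟩
    rw [hC₀.inf_eq_bot] at this
    simpa using this
  have hdim : finrank K (Y ⊔ U : Submodule K E) = finrank K Y + finrank K C := by
    have := Submodule.finrank_sup_add_finrank_inf_eq Y C
    rw [hYCd, finrank_bot, hYC] at this
    omega
  set N := 𝒜'.map (LinearMap.lcomp K E (Y ⊔ U).subtype) with hN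
  let π : N →ₗ[K] (Y →ₗ[K] E) :=
    (LinearMap.lcomp K E (Submodule.inclusion (le_sup_left : Y ≤ Y ⊔ U))) ∘ₗ N.subtype
  have hrange : LinearMap.range π ≤ 𝒜.map (LinearMap.lcomp K E Y.subtype) := by
    rintro _ ⟨⟨_, A, hA, rfl⟩, rfl⟩
    exact ⟨A, h𝒜 hA, rfl⟩
  have hCY : ∀ c : C, (c : E) ∈ Y ⊔ U := fun c => Submodule.mem_sup_right (hCU c.2)
  have hmaps : ∀ B ∈ N, ∀ c : C, B ⟨c, hCY c⟩ ∈ U := by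
    rintro _ ⟨A, hA, rfl⟩ c
    exact hst A hA c (hCU c.2)
  let κ : LinearMap.ker π →ₗ[K] (C →ₗ[K] U) :=
    { toFun := fun B =>
        { toFun := fun c => ⟨(B : N).1 ⟨c, hCY c⟩, hmaps _ (B : N).2 c⟩
          map_add' := fun c c' => Subtype.ext ((B : N).1.map_add ⟨c, hCY c⟩ ⟨c', hCY c'⟩)
          map_smul' := fun a c => Subtype.ext ((B : N).1.map_smul a ⟨c, hCY c⟩) }
      map_add' := fun B B' => rfl
      map_smul' := fun a B => rfl }
  have hκ : Function.Injective κ := by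
    rintro ⟨⟨B, hB⟩, hk⟩ ⟨⟨B', hB'⟩, hk'⟩ h0
    refine Subtype.ext (Subtype.ext (LinearMap.ext ?_))
    rintro ⟨x, hx⟩
    have hx' := hx
    rw [← hYC] at hx'
    obtain ⟨y, hy, c, hc, rfl⟩ := Submodule.mem_sup.1 hx'
    have e1 : ∀ B : N, B ∈ LinearMap.ker π → B.1 ⟨y, Submodule.mem_sup_left hy⟩ = 0 :=
      fun B hk => LinearMap.congr_fun (LinearMap.mem_ker.1 hk) ⟨y, hy⟩
    have e2 : B ⟨c, hCY ⟨c, hc⟩⟩ = B' ⟨c, hCY ⟨c, hc⟩⟩ :=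
      congrArg Subtype.val (LinearMap.congr_fun h0 ⟨c, hc⟩)
    have e3 := fun B : (Y ⊔ U : Submodule K E) →ₗ[K] E =>
      B.map_add ⟨y, Submodule.mem_sup_left hy⟩ ⟨c, hCY ⟨c, hc⟩⟩
    have e4 := e3 B
    have e5 := e3 B'
    rw [e1 ⟨B, hB⟩ hk] at e4
    rw [e1 ⟨B', hB'⟩ hk', ← e2] at e5
    exact e4.trans e5.symm
  have h1 := π.finrank_range_add_finrank_ker
  have h2 := Submodule.finrank_mono hrange
  have h3 := LinearMap.finrank_le_finrank_of_injective hκ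
  rw [Module.finrank_linearMap] at h3
  have h4 : finrank K C * finrank K U ≤ m * finrank K C := by
    rw [mul_comm]
    exact Nat.mul_le_mul_right _ hU
  rw [hdim, mul_add]
  omega

theorem potential_mono {m : ℕ} {𝒜 𝒜' : Submodule K (E →ₗ[K] E)} (h𝒜 : 𝒜' ≤ 𝒜)
    {Y U : Submodule K E} (hU : finrank K U ≤ m) (hst : ∀ A ∈ 𝒜', ∀ u ∈ U, A u ∈ U) :
    potential m 𝒜 Y ≤ potential m 𝒜' (Y ⊔ U) := by
  have h1 := finrank_map_restrict_sup_le h𝒜 (Y := Y) hU hst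
  have h2 := Submodule.finrank_mono (le_sup_left : Y ≤ Y ⊔ U)
  rw [potential, potential]
  zify at h1 h2
  linarith

/-- If `U ≤ Y`, the restricted algebra itself drops. Otherwise `dim Y` increases, and the
coefficient `m + 1` exceeds by one the cost `m` of each new dimension. -/
theorem potential_strict {m : ℕ} {𝒜 𝒜' : Submodule K (E →ₗ[K] E)} (h𝒜 : 𝒜' ≤ 𝒜)
    {Y U : Submodule K E} (hU : finrank K U ≤ m) (hst : ∀ A ∈ 𝒜', ∀ u ∈ U, A u ∈ U)
    (hne : ∃ A ∈ 𝒜, ∃ u ∈ U, A u ∉ U) :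
    potential m 𝒜 Y < potential m 𝒜' (Y ⊔ U) := by
  by_cases hUY : U ≤ Y
  · rw [sup_eq_left.2 hUY, potential, potential]
    have : 𝒜'.map (LinearMap.lcomp K E Y.subtype) < 𝒜.map (LinearMap.lcomp K E Y.subtype) := by
      refine lt_of_le_of_ne (Submodule.map_mono h𝒜) fun h => ?_
      obtain ⟨A, hA, u, hu, hAu⟩ := hne
      have := Submodule.mem_map_of_mem (f := LinearMap.lcomp K E Y.subtype) hA
      rw [← h] at this
      obtain ⟨A', hA', e⟩ := this
      have e' : A' u = A u := LinearMap.congr_fun e ⟨u, hUY hu⟩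
      exact hAu (e' ▸ hst A' hA' u hu)
    have := Submodule.finrank_lt_finrank_of_lt this
    omega
  · have h1 := finrank_map_restrict_sup_le h𝒜 (Y := Y) hU hst
    have h2 := Submodule.finrank_lt_finrank_of_lt (left_lt_sup.2 hUY)
    rw [potential, potential]
    zify at h1 h2
    linarith

end Potential

/-! ### Chains of subgroups against a subgroup of bounded index -/

section Chains

theorem chain_bound {G : Type*} [Group G] [Finite G] (S : Subgroup G) (H : ℕ → Subgroup G)
    (l : ℕ) (h0 : H 0 = ⊤) (hlt : ∀ k < l, H (k + 1) < H k) (Φ : ℕ → ℕ) (hΦ0 : Φ 0 = 0)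
    (hΦ : ∀ k < l, Φ k ≤ Φ (k + 1))
    (hΦ' : ∀ k < l, (∃ g ∈ S, g ∈ H k ∧ g ∉ H (k + 1)) → Φ k < Φ (k + 1)) :
    2 ^ l ≤ 2 ^ Φ l * S.index := by
  have hfin : ∀ A B : Subgroup G, A.relIndex B ≠ 0 := fun _ _ => Subgroup.index_ne_zero_of_finite
  -- The invariant weighs the steps so far against `[H k : S ∩ H k]`: a step that shrinks `S ∩ H k`
  -- is paid for by `Φ`, any other at least halves this index.
  have key : ∀ k ≤ l, 2 ^ k * S.relIndex (H k) ≤ 2 ^ Φ k * S.index := by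
    intro k
    induction k with
    | zero => intro _; simp [h0, hΦ0, Subgroup.relIndex_top_right]
    | succ k ih =>
      intro hk
      have hk' : k < l := hk
      have ih := ih hk'.le
      have hle := (hlt k hk').le
      have hpow : 2 ^ Φ k ≤ 2 ^ Φ (k + 1) := Nat.pow_le_pow_right (by norm_num) (hΦ k hk')
      by_cases hS : ∃ g ∈ S, g ∈ H k ∧ g ∉ H (k + 1)
      · have h1 : S.relIndex (H (k + 1)) ≤ S.relIndex (H k) :=
          Subgroup.relIndex_le_of_le_right hle (hfin _ _)
        have h2 : 2 ^ Φ k * 2 ≤ 2 ^ Φ (k + 1) := by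
          rw [← pow_succ]
          exact Nat.pow_le_pow_right (by norm_num) (hΦ' k hk' hS)
        calc 2 ^ (k + 1) * S.relIndex (H (k + 1)) ≤ 2 ^ (k + 1) * S.relIndex (H k) := by gcongr
          _ = (2 ^ k * S.relIndex (H k)) * 2 := by ring
          _ ≤ (2 ^ Φ k * S.index) * 2 := by gcongr
          _ = (2 ^ Φ k * 2) * S.index := by ring
          _ ≤ 2 ^ Φ (k + 1) * S.index := by gcongr
      · have hinf : S ⊓ H (k + 1) = S ⊓ H k := by
          refine le_antisymm (inf_le_inf_left _ hle) fun g hg => ⟨hg.1, ?_⟩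
          by_contra hn
          exact hS ⟨g, hg.1, hg.2, hn⟩
        have h1 : S.relIndex (H (k + 1)) * (H (k + 1)).relIndex (H k) = S.relIndex (H k) := by
          rw [← Subgroup.inf_relIndex_right S (H (k + 1)), ← Subgroup.inf_relIndex_right S (H k),
            ← hinf]
          exact Subgroup.relIndex_mul_relIndex _ _ _ inf_le_right hle
        have h2 : 2 ≤ (H (k + 1)).relIndex (H k) := by
          have h3 : (H (k + 1)).relIndex (H k) ≠ 0 := (hfin _ _)
          have h4 : (H (k + 1)).relIndex (H k) ≠ 1 := fun h =>
            (hlt k hk').not_ge (Subgroup.relIndex_eq_one.1 h)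
          omega
        calc 2 ^ (k + 1) * S.relIndex (H (k + 1)) = 2 ^ k * (S.relIndex (H (k + 1)) * 2) := by ring
          _ ≤ 2 ^ k * (S.relIndex (H (k + 1)) * (H (k + 1)).relIndex (H k)) := by gcongr
          _ = 2 ^ k * S.relIndex (H k) := by rw [h1]
          _ ≤ 2 ^ Φ k * S.index := ih
          _ ≤ 2 ^ Φ (k + 1) * S.index := by gcongr
  have h1 := key l le_rfl
  have h2 : 0 < S.relIndex (H l) := Nat.pos_of_ne_zero (hfin _ _)
  calc 2 ^ l = 2 ^ l * 1 := (mul_one _).symm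
    _ ≤ 2 ^ l * S.relIndex (H l) := by gcongr; exact h2
    _ ≤ _ := h1

end Chains

/-! ### Algebras stabilizing pairs of subspaces -/

section PairStabilizers

variable {K V α : Type*} [Field K] [AddCommGroup V] [Module K V] [FiniteDimensional K V]

/-- The endomorphisms preserving the subspaces `U p` and `W p` for all `p ∈ T`. -/
def pairStabilizer (U W : α → Submodule K V) (T : Set α) : Submodule K (V →ₗ[K] V) where
  carrier := {A | ∀ p ∈ T, (∀ u ∈ U p, A u ∈ U p) ∧ ∀ w ∈ W p, A w ∈ W p}
  add_mem' := fun hA hB p hp =>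
    ⟨fun u hu => (U p).add_mem ((hA p hp).1 u hu) ((hB p hp).1 u hu),
      fun w hw => (W p).add_mem ((hA p hp).2 w hw) ((hB p hp).2 w hw)⟩
  zero_mem' := fun p _ => ⟨fun _ _ => (U p).zero_mem, fun _ _ => (W p).zero_mem⟩
  smul_mem' := fun a _ hA p hp =>
    ⟨fun u hu => (U p).smul_mem a ((hA p hp).1 u hu),
      fun w hw => (W p).smul_mem a ((hA p hp).2 w hw)⟩

variable {U W : α → Submodule K V} {T : Set α}

theorem mem_pairStabilizer {A : V →ₗ[K] V} : A ∈ pairStabilizer U W T ↔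
    ∀ p ∈ T, (∀ u ∈ U p, A u ∈ U p) ∧ ∀ w ∈ W p, A w ∈ W p := Iff.rfl

theorem pairStabilizer_anti {T' : Set α} (h : T ⊆ T') :
    pairStabilizer U W T' ≤ pairStabilizer U W T := fun _ hA p hp => hA p (h hp)

variable (U W) in
/-- The sum of the potentials of the stabilizer acting on the span of the subspaces `U p` and of
its dual acting on the span of the annihilators of the subspaces `W p`. -/
noncomputable def pairPotential (m : ℕ) (T : Set α) : ℤ :=
  potential m (pairStabilizer U W T) (⨆ p ∈ T, U p) +
    potential m ((pairStabilizer U W T).map (Dual.transpose (R := K) (M := V) (M' := V)))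
      (⨆ p ∈ T, (W p).dualAnnihilator)

theorem pairPotential_empty (m : ℕ) : pairPotential U W m ∅ = 0 := by
  simp [pairPotential, potential_bot]

theorem pairPotential_le (m : ℕ) : pairPotential U W m T ≤ 2 * ((m + 1) * finrank K V) := by
  have h1 := potential_le_mul m (pairStabilizer U W T) (⨆ p ∈ T, U p)
  have h2 := potential_le_mul m
    ((pairStabilizer U W T).map (Dual.transpose (R := K) (M := V) (M' := V)))
      (⨆ p ∈ T, (W p).dualAnnihilator)
  rw [Subspace.dual_finrank_eq] at h2
  rw [pairPotential]
  linarith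

variable {m : ℕ} (hU : ∀ p, finrank K (U p) = m) (hW : ∀ p, finrank K (W p) = finrank K V - m)
  (hm : m ≤ finrank K V)

include hW hm in
theorem finrank_dualAnnihilator_eq (p : α) : finrank K (W p).dualAnnihilator = m := by
  have := Subspace.finrank_add_finrank_dualAnnihilator_eq (W p)
  have := hW p
  omega

theorem transpose_pairStabilizer_mem (p : α) (hp : p ∈ T) :
    ∀ A ∈ (pairStabilizer U W T).map (Dual.transpose (R := K) (M := V) (M' := V)),
      ∀ f ∈ (W p).dualAnnihilator, A f ∈ (W p).dualAnnihilator := by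
  rintro _ ⟨A, hA, rfl⟩ f hf
  rw [Submodule.mem_dualAnnihilator] at hf ⊢
  exact fun w hw => hf _ ((hA p hp).2 w hw)

include hU hW hm in
theorem pairPotential_mono (p : α) : pairPotential U W m T ≤ pairPotential U W m (insert p T) := by
  rw [pairPotential, pairPotential, iSup_insert, iSup_insert, sup_comm, sup_comm (W p).dualAnnihilator]
  have h := pairStabilizer_anti (U := U) (W := W) (Set.subset_insert p T)
  exact add_le_add
    (potential_mono h (hU p).le fun A hA => (hA p (Set.mem_insert p T)).1)
    (potential_mono (Submodule.map_mono h) (finrank_dualAnnihilator_eq hW hm p).le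
      (transpose_pairStabilizer_mem p (Set.mem_insert p T)))

include hU hW hm in
-- A map that fails to preserve the pair fails on `U p`, or its transpose fails on the annihilator
-- of `W p`; the corresponding summand grows strictly.
theorem pairPotential_strict (p : α) {A : V →ₗ[K] V} (hA : A ∈ pairStabilizer U W T)
    (hA' : A ∉ pairStabilizer U W (insert p T)) :
    pairPotential U W m T < pairPotential U W m (insert p T) := by
  rw [pairPotential, pairPotential, iSup_insert, iSup_insert, sup_comm, sup_comm (W p).dualAnnihilator]
  have h := pairStabilizer_anti (U := U) (W := W) (Set.subset_insert p T)
  have hst := fun A (hA : A ∈ pairStabilizer U W (insert p T)) => (hA p (Set.mem_insert p T)).1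
  have hst' := transpose_pairStabilizer_mem (U := U) (W := W) p (Set.mem_insert p T)
  by_cases hAU : ∀ u ∈ U p, A u ∈ U p
  · refine add_lt_add_of_le_of_lt (potential_mono h (hU p).le hst)
      (potential_strict (Submodule.map_mono h) (finrank_dualAnnihilator_eq hW hm p).le hst'
        ⟨_, ⟨A, hA, rfl⟩, ?_⟩)
    by_contra! H
    refine hA' fun p' hp' => ?_
    rcases Set.mem_insert_iff.1 hp' with rfl | hp'
    · refine ⟨hAU, fun w hw => ?_⟩
      by_contra hAw
      obtain ⟨f, hf, hf'⟩ := Submodule.exists_le_ker_of_notMem hAw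
      have := H f ((Submodule.mem_dualAnnihilator _).2 fun w hw => hf' hw)
      exact hf ((Submodule.mem_dualAnnihilator _).1 this w hw)
    · exact hA p' hp'
  · push Not at hAU
    exact add_lt_add_of_lt_of_le (potential_strict h (hU p).le hst ⟨A, hA, hAU⟩)
      (potential_mono (Submodule.map_mono h) (finrank_dualAnnihilator_eq hW hm p).le hst')

end PairStabilizers

/-! ### The socle of an almost simple group -/

section Socle

/-- The preimage of `Inn(S)` is a minimal normal subgroup, hence lies in the socle. An automorphism
commuting with every inner automorphism moves each `s` by a central factor, and `S` has trivial
centre. -/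
theorem IsAlmostSimple.centralizer_socle {G : Type*} [Group G] (hG : IsAlmostSimple G) {g : G}
    (hg : ∀ x ∈ groupSocle G, Commute g x) : g = 1 := by
  obtain ⟨S, _, φ, hS, ⟨a, b, hab⟩, hφ, hinn⟩ := hG
  have hconj : ∀ (f : MulAut S) (s : S), f * MulAut.conj s * f⁻¹ = MulAut.conj (f s) := by
    intro f s
    ext x
    simp
  have hcenter : ∀ s : S, MulAut.conj s = 1 → s = 1 := by
    intro s hs
    have hsc : s ∈ Subgroup.center S := by
      rw [Subgroup.mem_center_iff]
      intro t
      have := DFunLike.congr_fun hs t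
      rw [MulAut.conj_apply, MulAut.one_apply, mul_inv_eq_iff_eq_mul] at this
      exact this.symm
    rcases hS.eq_bot_or_eq_top_of_normal (Subgroup.center S) inferInstance with h | h
    · rwa [h, Subgroup.mem_bot] at hsc
    · have : a ∈ Subgroup.center S := h ▸ Subgroup.mem_top a
      exact absurd (Subgroup.mem_center_iff.1 this b).symm hab
  have hlift : ∀ s : S, ∃ x : G, φ x = MulAut.conj s := fun s => hinn ⟨s, rfl⟩
  let I : Subgroup G := (MulAut.conj : S →* MulAut S).range.comap φ
  have hI : IsMinimalNormal I := by
    refine ⟨⟨⟨?_⟩, ?_⟩, ?_⟩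
    · rintro x ⟨s, hs⟩ y
      refine ⟨φ y s, ?_⟩
      rw [map_mul, map_mul, map_inv, ← hs, hconj]
    · intro h
      obtain ⟨x, hx⟩ := hlift a
      have : x ∈ I := ⟨a, hx.symm⟩
      rw [h, Subgroup.mem_bot] at this
      rw [this, map_one] at hx
      have := hcenter a hx.symm
      exact hab (by simp [this])
    · rintro M ⟨hM, hM0⟩ hMI x ⟨s, hs⟩
      let N : Subgroup S := (M.map φ).comap MulAut.conj
      have hN : N.Normal := by
        refine ⟨?_⟩
        rintro s ⟨x, hx, hxs⟩ t
        obtain ⟨y, hy⟩ := hlift t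
        exact ⟨y * x * y⁻¹, hM.conj_mem x hx y, by simp [hxs, hy]⟩
      have hN0 : N ≠ ⊥ := by
        obtain ⟨⟨z, hz⟩, hz1⟩ := Subgroup.ne_bot_iff_exists_ne_one.1 hM0
        obtain ⟨t, ht⟩ := hMI hz
        intro h
        have : t ∈ N := ⟨z, hz, ht.symm⟩
        rw [h, Subgroup.mem_bot] at this
        rw [this, map_one] at ht
        exact hz1 (Subtype.ext (hφ (ht.symm.trans (map_one φ).symm)))
      have hNtop := (hS.eq_bot_or_eq_top_of_normal N hN).resolve_left hN0
      have : s ∈ N := hNtop ▸ Subgroup.mem_top s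
      obtain ⟨z, hz, hzs⟩ := this
      have : z = x := hφ (hzs.trans hs)
      exact this ▸ hz
  have hle : I ≤ groupSocle G := le_sSup hI
  apply hφ
  rw [map_one]
  ext s
  obtain ⟨x, hx⟩ := hlift s
  have hc := (hg x (hle ⟨s, hx.symm⟩)).map φ
  rw [hx] at hc
  have h1 := hconj (φ g) s
  rw [hc.eq, mul_inv_cancel_right] at h1
  have h2 := hcenter (s * (φ g s)⁻¹) (by rw [map_mul, map_inv, ← h1, mul_inv_cancel])
  rw [MulAut.one_apply]
  exact (mul_inv_eq_one.1 h2).symm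

theorem normal_groupSocle (G : Type*) [Group G] : (groupSocle G).Normal :=
  Subgroup.sSup_normal _ fun _ hN => hN.1.1

end Socle

/-! ### Subspaces, shears and the number of pairs -/

section Subspaces

variable {K V : Type*} [Field K] [AddCommGroup V] [Module K V] [FiniteDimensional K V]

theorem exists_subspace_between {A B : Submodule K V} (hAB : A ≤ B) {k : ℕ}
    (hk : finrank K A ≤ k) (hkB : k ≤ finrank K B) :
    ∃ U : Submodule K V, A ≤ U ∧ U ≤ B ∧ finrank K U = k := by
  induction k, hk using Nat.le_induction with
  | base => exact ⟨A, le_rfl, hAB, rfl⟩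
  | succ k hk ih =>
    obtain ⟨U, hAU, hUB, hU⟩ := ih (by omega)
    have hlt : U < B := lt_of_le_of_ne hUB fun h => by rw [h] at hU; omega
    obtain ⟨x, hxB, hxU⟩ := SetLike.exists_of_lt hlt
    refine ⟨U ⊔ Submodule.span K {x}, hAU.trans le_sup_left, sup_le hUB ?_, ?_⟩
    · rwa [Submodule.span_singleton_le_iff_mem]
    · have h0 : x ≠ 0 := by rintro rfl; exact hxU U.zero_mem
      have h1 := Submodule.finrank_sup_add_finrank_inf_eq U (Submodule.span K {x})
      have h2 : U ⊓ Submodule.span K {x} = ⊥ :=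
        ((Submodule.disjoint_span_singleton' h0).2 hxU).eq_bot
      rw [h2, finrank_bot, finrank_span_singleton h0] at h1
      omega

/-- A linear map preserving all subspaces of dimension `m` is a homothety. -/
theorem exists_smul_id_of_forall_finrank {m : ℕ} (hm : 1 ≤ m) (hmd : m < finrank K V)
    {g : V →ₗ[K] V} (h : ∀ U : Submodule K V, finrank K U = m → ∀ u ∈ U, g u ∈ U) :
    ∃ a : K, g = a • 1 := by
  refine LinearMap.exists_eq_smul_id_of_forall_notLinearIndependent fun v hv => ?_
  rw [LinearIndependent.pair_iff] at hv
  have hv0 : v ≠ 0 := by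
    rintro rfl
    exact one_ne_zero (hv 1 0 (by simp)).1
  have hgv : g v ∉ Submodule.span K {v} := by
    intro hmem
    obtain ⟨a, ha⟩ := Submodule.mem_span_singleton.1 hmem
    have := (hv a (-1) (by rw [ha]; simp)).2
    exact one_ne_zero (neg_eq_zero.1 this)
  obtain ⟨f, hf, hf'⟩ := Submodule.exists_le_ker_of_notMem hgv
  have h1 := f.finrank_range_add_finrank_ker
  have h2 : finrank K (LinearMap.range f) ≤ 1 := by
    simpa using Submodule.finrank_le (LinearMap.range f)
  obtain ⟨U, hvU, hUf, hU⟩ := exists_subspace_between hf' (k := m)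
    (by rw [finrank_span_singleton hv0]; exact hm) (by omega)
  exact hf (hUf (h U hU v (hvU (Submodule.mem_span_singleton_self v))))

/-- The shear `x ↦ x + h (π x)`, where `π` is the projection onto `A` along `B`. -/
noncomputable def shear {A B : Submodule K V} (hAB : IsCompl A B) (h : A →ₗ[K] B) : V ≃ₗ[K] V :=
  LinearEquiv.ofLinearMap
    (LinearMap.id + B.subtype ∘ₗ h ∘ₗ A.projectionOnto B hAB)
    (LinearMap.id - B.subtype ∘ₗ h ∘ₗ A.projectionOnto B hAB)
    (by ext x; simp [Submodule.projectionOnto_apply_right])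
    (by ext x; simp [Submodule.projectionOnto_apply_right])

theorem shear_apply {A B : Submodule K V} (hAB : IsCompl A B) (h : A →ₗ[K] B) (x : V) :
    shear hAB h x = x + h (A.projectionOnto B hAB x) := rfl

theorem shear_map_injective {A B : Submodule K V} (hAB : IsCompl A B) {h h' : A →ₗ[K] B}
    (e : A.map (shear hAB h : V →ₗ[K] V) = A.map (shear hAB h' : V →ₗ[K] V)) : h = h' := by
  ext a
  have : shear hAB h (a : V) ∈ A.map (shear hAB h' : V →ₗ[K] V) :=
    e ▸ Submodule.mem_map_of_mem a.2
  obtain ⟨a', ha', e'⟩ := this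
  rw [LinearEquiv.coe_coe, shear_apply, shear_apply,
    Submodule.projectionOnto_apply_of_mem_left hAB ha',
    Submodule.projectionOnto_apply_left] at e'
  have h1 : (a' : V) - a ∈ A ⊓ B := by
    refine ⟨A.sub_mem ha' a.2, ?_⟩
    have : (a' : V) - a = (h a : V) - h' ⟨a', ha'⟩ := by
      rw [sub_eq_sub_iff_add_eq_add, e', add_comm]
    rw [this]
    exact B.sub_mem (h a).2 (h' _).2
  rw [hAB.inf_eq_bot, Submodule.mem_bot, sub_eq_zero] at h1
  subst h1
  exact (add_left_cancel e').symm

theorem mapPair_mk (g : V ≃ₗ[K] V) (U W : Submodule K V) :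
    mapPair g s(U, W) = s(U.map (g : V →ₗ[K] V), W.map (g : V →ₗ[K] V)) := rfl

theorem pair_eq_of_finrank {U W U' W' : Submodule K V} {m n : ℕ} (hmn : m ≠ n)
    (hU : finrank K U = m) (hU' : finrank K U' = m) (hW' : finrank K W' = n)
    (h : s(U, W) = s(U', W')) : U = U' ∧ W = W' := by
  rcases Sym2.eq_iff.1 h with h | ⟨rfl, rfl⟩
  · exact h
  · omega

/-- A shear of `U` along `D ≤ W` leaves `W` in place; a second shear then moves `W` along its
complement `C`. The image of `W` recovers the second shear, after which the image of `U` recovers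
the first. This gives `|Hom(W, C)| · |Hom(U, D)|` distinct pairs. -/
theorem pow_le_card_pairs [Finite K] {Ω : Set (Sym2 (Submodule K V))} (hΩ : LinearlyInvariant Ω)
    {U W C C' D : Submodule K V} (hp : s(U, W) ∈ Ω) (hne : finrank K U ≠ finrank K W)
    (hWC : IsCompl W C) (hUC : IsCompl U C') (hDC : D ≤ C') (hDW : D ≤ W) :
    Nat.card K ^ (finrank K W * finrank K C + finrank K U * finrank K D) ≤ Nat.card Ω := by
  have : Finite V := Module.finite_of_finite K
  have : Finite (Submodule K V) := Finite.of_injective _ SetLike.coe_injective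
  have : Finite (Sym2 (Submodule K V)) := Quot.finite _
  let ext (k : U →ₗ[K] D) : U →ₗ[K] C' := Submodule.inclusion hDC ∘ₗ k
  let F : (W →ₗ[K] C) × (U →ₗ[K] D) → Ω := fun hk =>
    ⟨mapPair (shear hWC hk.1) (mapPair (shear hUC (ext hk.2)) s(U, W)), hΩ _ _ (hΩ _ _ hp)⟩
  have hk : ∀ k : U →ₗ[K] D, W.map (shear hUC (ext k) : V →ₗ[K] V) = W := by
    intro k
    refine Submodule.eq_of_le_of_finrank_eq ?_ (LinearEquiv.finrank_map_eq _ W)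
    rintro _ ⟨w, hw, rfl⟩
    rw [LinearEquiv.coe_coe, shear_apply]
    exact W.add_mem hw (hDW (k _).2)
  have hF : Function.Injective F := by
    rintro ⟨h, k⟩ ⟨h', k'⟩ e
    have e := congrArg Subtype.val e
    simp only [F, mapPair_mk, hk] at e
    obtain ⟨e1, e2⟩ := pair_eq_of_finrank hne
      ((LinearEquiv.finrank_map_eq _ _).trans (LinearEquiv.finrank_map_eq _ _))
      ((LinearEquiv.finrank_map_eq _ _).trans (LinearEquiv.finrank_map_eq _ _))
      (LinearEquiv.finrank_map_eq _ _) e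
    obtain rfl := shear_map_injective hWC e2
    have e3 := Submodule.map_injective_of_injective (shear hWC h).injective e1
    have e4 := shear_map_injective hUC e3
    refine Prod.ext rfl (LinearMap.ext fun u => ?_)
    exact Submodule.inclusion_injective hDC (LinearMap.congr_fun e4 u)
  have := Nat.card_le_card_of_injective F hF
  rwa [Nat.card_prod, Module.natCard_eq_pow_finrank (K := K),
    Module.natCard_eq_pow_finrank (K := K) (V := U →ₗ[K] D), Module.finrank_linearMap,
    Module.finrank_linearMap, ← pow_add] at this

end Subspaces

/-! ### Assembling the estimates -/

section Main

variable {K V : Type*} [Field K] [Finite K] [AddCommGroup V] [Module K V] [FiniteDimensional K V]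

theorem coe_slPerm_apply (Ω : Set (Sym2 (Submodule K V))) (hΩ : LinearlyInvariant Ω)
    (g : SpecialLinearGroup K V) (p : Ω) :
    (slPerm Ω hΩ g p : Sym2 (Submodule K V)) = mapPair (g : V ≃ₗ[K] V) p := rfl

theorem range_pslPerm (Ω : Set (Sym2 (Submodule K V))) (hΩ : LinearlyInvariant Ω) :
    (pslPerm Ω hΩ).range = (slPerm Ω hΩ).range := by
  ext x
  constructor
  · rintro ⟨y, rfl⟩
    obtain ⟨g, rfl⟩ := QuotientGroup.mk_surjective y
    exact ⟨g, rfl⟩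
  · rintro ⟨g, rfl⟩
    exact ⟨(g : ProjectiveSL K V), rfl⟩

theorem mapPair_eq_iff {m n : ℕ} (hmn : m ≠ n) {U W : Submodule K V} (hU : finrank K U = m)
    (hW : finrank K W = n) (g : V ≃ₗ[K] V) :
    mapPair g s(U, W) = s(U, W) ↔ (∀ u ∈ U, g u ∈ U) ∧ ∀ w ∈ W, g w ∈ W := by
  rw [mapPair_mk]
  constructor
  · intro h
    obtain ⟨h1, h2⟩ := pair_eq_of_finrank hmn ((LinearEquiv.finrank_map_eq g U).trans hU) hU hW h
    exact ⟨fun u hu => h1 ▸ Submodule.mem_map_of_mem hu,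
      fun w hw => h2 ▸ Submodule.mem_map_of_mem hw⟩
  · rintro ⟨h1, h2⟩
    rw [Submodule.eq_of_le_of_finrank_eq (Submodule.map_le_iff_le_comap.2 h1)
        (LinearEquiv.finrank_map_eq g U),
      Submodule.eq_of_le_of_finrank_eq (Submodule.map_le_iff_le_comap.2 h2)
        (LinearEquiv.finrank_map_eq g W)]

/-- Every `m`-dimensional subspace occurs in some pair, so the kernel consists of homotheties. In
characteristic `p` a scalar with `a ^ p ^ k = 1` is `1`. -/
theorem isCentralEmbedding_of_almostSimple (p : ℕ) [Fact p.Prime] [CharP K p]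
    {Ω : Set (Sym2 (Submodule K V))} {hΩ : LinearlyInvariant Ω} {m : ℕ} (hm : 1 ≤ m)
    (hmd : 2 * m < finrank K V)
    (hex : ∀ U : Submodule K V, finrank K U = m →
      ∃ W : Submodule K V, finrank K W = finrank K V - m ∧ s(U, W) ∈ Ω)
    {G : Subgroup (Equiv.Perm Ω)} (hG : IsAlmostSimple G)
    {ρ : SpecialLinearGroup K V →* G} (hρ : ∀ s, (ρ s : Equiv.Perm Ω) = slPerm Ω hΩ s)
    (hsoc : ρ.range = groupSocle G) : IsCentralEmbedding p ρ := by
  have hker : ∀ z ∈ ρ.ker, ∃ a : K, ((z : V ≃ₗ[K] V) : V →ₗ[K] V) = a • 1 := by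
    intro z hz
    refine exists_smul_id_of_forall_finrank hm (by omega) fun U hU => ?_
    obtain ⟨W, hW, hp⟩ := hex U hU
    have h1 : slPerm Ω hΩ z = 1 := by rw [← hρ, MonoidHom.mem_ker.1 hz, Subgroup.coe_one]
    have h2 : mapPair (z : V ≃ₗ[K] V) s(U, W) = s(U, W) :=
      congrArg Subtype.val (Equiv.congr_fun h1 ⟨_, hp⟩)
    exact ((mapPair_eq_iff (by omega) hU hW _).1 h2).1
  refine ⟨hsoc ▸ normal_groupSocle G, fun z hz => ?_, fun z hz k hk => ?_, fun g hg => ?_⟩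
  · obtain ⟨a, ha⟩ := hker z hz
    have ha' : ∀ x : V, z • x = a • x := fun x => LinearMap.congr_fun ha x
    rw [Subgroup.mem_center_iff]
    refine fun g => SL_ext fun x => ?_
    rw [mul_smul, mul_smul, ha', ha', SL_smul_smul]
  · obtain ⟨a, ha⟩ := hker z hz
    have ha' : ∀ x : V, z • x = a • x := fun x => LinearMap.congr_fun ha x
    have hpow : ∀ (n : ℕ) (x : V), z ^ n • x = a ^ n • x := by
      intro n x
      induction n with
      | zero => simp
      | succ n ih => rw [pow_succ', mul_smul, ih, ha', smul_smul, ← pow_succ']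
    have : Nontrivial V := Module.nontrivial_of_finrank_pos (R := K) (by omega)
    obtain ⟨x, hx⟩ := exists_ne (0 : V)
    have h1 := hpow (p ^ k) x
    rw [hk, one_smul] at h1
    have h2 : a ^ p ^ k = 1 := by
      have h3 : (a ^ p ^ k - 1) • x = 0 := by rw [sub_smul, one_smul, ← h1, sub_self]
      exact sub_eq_zero.1 ((smul_eq_zero.1 h3).resolve_right hx)
    have h4 : a = 1 := by
      have : ExpChar K p := ExpChar.prime Fact.out
      have := (ExpChar.pow_prime_pow_mul_eq_one_iff p k 1 a).1 (by rwa [mul_one])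
      rwa [pow_one] at this
    exact SL_ext fun y => by rw [ha', h4, one_smul, one_smul]
  · refine hG.centralizer_socle fun x hx => ?_
    rw [← hsoc] at hx
    obtain ⟨s, rfl⟩ := hx
    exact hg s

theorem length_bound {Ω : Set (Sym2 (Submodule K V))} {hΩ : LinearlyInvariant Ω} {m : ℕ}
    (hmd : 2 * m < finrank K V)
    (hdim : ∀ p ∈ Ω, ∃ U W : Submodule K V, p = s(U, W) ∧ finrank K U = m ∧
      finrank K W = finrank K V - m)
    {G : Subgroup (Equiv.Perm Ω)} {ρ : SpecialLinearGroup K V →* G}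
    (hρ : ∀ s, (ρ s : Equiv.Perm Ω) = slPerm Ω hΩ s) {l : List Ω} (hl : IsStrictSeq G l) :
    2 ^ l.length ≤ 2 ^ (2 * ((m + 1) * finrank K V)) * ρ.range.index ∧
      2 ^ l.length ≤ 2 ^ (finrank K V ^ 2 - 1) * ρ.range.index := by
  have : Finite V := Module.finite_of_finite K
  have : Finite (Submodule K V) := Finite.of_injective _ SetLike.coe_injective
  have : Finite (Sym2 (Submodule K V)) := Quot.finite _
  have hdim' : ∀ p : Ω, ∃ U W : Submodule K V, (p : Sym2 (Submodule K V)) = s(U, W) ∧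
    finrank K U = m ∧ finrank K W = finrank K V - m := fun p => hdim p p.2
  choose U W hUW hU hW using hdim'
  have hfix : ∀ (s : SpecialLinearGroup K V) (T : Set Ω), ρ s ∈ fixingSubgroup G T ↔
      ((s : V ≃ₗ[K] V) : V →ₗ[K] V) ∈ pairStabilizer U W T := by
    intro s T
    rw [mem_fixingSubgroup_iff, mem_pairStabilizer]
    refine forall₂_congr fun p _ => ?_
    have h1 : ρ s • p = p ↔ mapPair (s : V ≃ₗ[K] V) (p : Sym2 (Submodule K V)) = p := by
      rw [Subtype.ext_iff, ← coe_slPerm_apply Ω hΩ, ← hρ]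
      rfl
    rw [h1, hUW, mapPair_eq_iff (by omega) (hU p) (hW p)]
    rfl
  have hins : ∀ k (hk : k < l.length), {x | x ∈ l.take (k + 1)} = insert l[k] {x | x ∈ l.take k} := by
    intro k hk
    ext x
    simp only [List.take_succ_eq_append_getElem hk, List.mem_append, List.mem_singleton,
      Set.mem_insert_iff, Set.mem_ofPred_eq]
    exact or_comm
  let T : ℕ → Set Ω := fun k => {x | x ∈ l.take k}
  have hmem : ∀ k < l.length, (∃ g ∈ ρ.range, g ∈ seqStabilizer G (l.take k) ∧
      g ∉ seqStabilizer G (l.take (k + 1))) →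
      ∃ A ∈ pairStabilizer U W (T k), A ∉ pairStabilizer U W (T (k + 1)) := by
    rintro k - ⟨_, ⟨s, rfl⟩, h1, h2⟩
    exact ⟨_, (hfix s _).1 h1, fun h => h2 ((hfix s _).2 h)⟩
  have hT0 : T 0 = ∅ := by ext; simp [T]
  have h0 : seqStabilizer G (l.take 0) = ⊤ := by
    rw [Subgroup.eq_top_iff']
    intro g
    simp [seqStabilizer]
  have hidx := fun {n n' : ℕ} (h : n ≤ n') => Nat.mul_le_mul_right ρ.range.index
    (Nat.pow_le_pow_right (n := 2) (by norm_num) h)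
  constructor
  · have hmono : ∀ k < l.length, pairPotential U W m (T k) ≤ pairPotential U W m (T (k + 1)) := by
      intro k hk
      simp only [T, hins k hk]
      exact pairPotential_mono hU hW (by omega) _
    have hnn : ∀ k ≤ l.length, 0 ≤ pairPotential U W m (T k) := by
      intro k
      induction k with
      | zero => intro _; rw [hT0, pairPotential_empty]
      | succ k ih => intro hk; exact (ih (by omega)).trans (hmono k hk)
    refine (chain_bound ρ.range (fun k => seqStabilizer G (l.take k)) l.length h0 hl
      (fun k => (pairPotential U W m (T k)).toNat) (by simp [hT0, pairPotential_empty])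
      (fun k hk => Int.toNat_le_toNat (hmono k hk)) fun k hk h => ?_).trans (hidx ?_)
    · obtain ⟨A, hA, hA'⟩ := hmem k hk h
      have := hnn k hk.le
      have h3 : pairPotential U W m (T k) < pairPotential U W m (T (k + 1)) := by
        simp only [T, hins k hk] at hA' ⊢
        exact pairPotential_strict hU hW (by omega) _ hA hA'
      omega
    · have := pairPotential_le (U := U) (W := W) (T := T l.length) m
      zify
      rw [Int.toNat_of_nonneg (hnn _ le_rfl)]
      exact this
  · have hle : ∀ k, finrank K (pairStabilizer U W (T k)) ≤ finrank K V ^ 2 := by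
      intro k
      have := Submodule.finrank_le (pairStabilizer U W (T k))
      rwa [Module.finrank_linearMap, ← pow_two] at this
    -- The identity always survives in the algebra, which saves the `1` in `d ^ 2 - 1`, needed for
    -- `d = 3`.
    have hpos : ∀ k, 1 ≤ finrank K (pairStabilizer U W (T k)) := by
      intro k
      have : Nontrivial V := Module.nontrivial_of_finrank_pos (R := K) (by omega)
      have : Nontrivial (pairStabilizer U W (T k)) := by
        refine ⟨⟨0, ⟨LinearMap.id, fun p _ => ⟨fun u hu => hu, fun w hw => hw⟩⟩, fun h => ?_⟩⟩
        exact one_ne_zero (α := V →ₗ[K] V) (congrArg Subtype.val h).symm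
      exact Module.finrank_pos
    have hanti : ∀ k < l.length,
        pairStabilizer U W (T (k + 1)) ≤ pairStabilizer U W (T k) := by
      intro k hk
      simp only [T, hins k hk]
      exact pairStabilizer_anti (Set.subset_insert _ _)
    refine (chain_bound ρ.range (fun k => seqStabilizer G (l.take k)) l.length h0 hl
      (fun k => finrank K V ^ 2 - finrank K (pairStabilizer U W (T k))) ?_
      (fun k hk => ?_) fun k hk h => ?_).trans (hidx ?_)
    · have : pairStabilizer U W (T 0) = ⊤ := by
        rw [hT0, eq_top_iff]
        intro A _ p hp
        exact absurd hp (Set.notMem_empty p)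
      change _ - finrank K (pairStabilizer U W (T 0)) = 0
      rw [this, finrank_top, Module.finrank_linearMap, pow_two, Nat.sub_self]
    · have := Submodule.finrank_mono (hanti k hk)
      change _ - _ ≤ _ - _
      omega
    · obtain ⟨A, hA, hA'⟩ := hmem k hk h
      have := Submodule.finrank_lt_finrank_of_lt
        (lt_of_le_of_ne (hanti k hk) fun e => hA' (e ▸ hA))
      have := hle k
      change _ - _ < _ - _
      omega
    · exact Nat.sub_le_sub_left (hpos _) _

/-- With `E = 5 m (2d - 3m)` and `c = 2d - 1`, the inequality `4 (q - 1) ≤ q ^ 2` turns the index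
bound into `2 q ^ (2c) / 4 ^ c`. What remains is `Φ + 6 < E`, together with `2c ≤ E` so that the
leftover power of `2` can be replaced by one of `q`. -/
theorem two_pow_lt_of_bounds {q d m l n i : ℕ} (hq : 2 ≤ q) (hm : 1 ≤ m) (hmd : 2 * m < d)
    (hi : i ≤ 2 * (q - 1) ^ (2 * d - 1)) (h1 : 2 ^ l ≤ 2 ^ (2 * ((m + 1) * d)) * i)
    (h2 : 2 ^ l ≤ 2 ^ (d ^ 2 - 1) * i) (hn : q ^ (m * (2 * d - 3 * m)) ≤ n) :
    2 ^ (l + 5) < n ^ 5 := by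
  obtain ⟨Φ, hΦ, hE, hE'⟩ : ∃ Φ, 2 ^ l ≤ 2 ^ Φ * i ∧ Φ + 6 < 5 * (m * (2 * d - 3 * m)) ∧
      4 * d - 2 ≤ 5 * (m * (2 * d - 3 * m)) := by
    obtain ⟨e, rfl⟩ : ∃ e, d = 2 * m + 1 + e := ⟨d - (2 * m + 1), by omega⟩
    have hs : 2 * (2 * m + 1 + e) - 3 * m = m + 2 + 2 * e := by omega
    rw [hs]
    -- For `m = 1`, `d = 3` one has `E = 15`: the potential bound `12` is too weak, while `d ^ 2 - 1
    -- = 8` suffices.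
    by_cases h : m = 1 ∧ e = 0
    · obtain ⟨rfl, rfl⟩ := h
      exact ⟨_, h2, by norm_num, by norm_num⟩
    · refine ⟨_, h1, ?_, ?_⟩
      · rcases Nat.lt_or_ge m 2 with h' | h'
        · have : m = 1 := by omega
          subst this
          omega
        · nlinarith [Nat.zero_le (m * e), mul_le_mul h' h' (by norm_num) (by omega)]
      · have : 4 * (2 * m + 1 + e) - 2 = 8 * m + 2 + 4 * e := by omega
        rw [this]
        nlinarith [Nat.zero_le (m * e), mul_le_mul hm hm (by norm_num) (by omega)]
  have hq4 : 4 * (q - 1) ≤ q ^ 2 := by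
    obtain ⟨r, rfl⟩ : ∃ r, q = r + 2 := ⟨q - 2, by omega⟩
    have : r + 2 - 1 = r + 1 := by omega
    rw [this]
    nlinarith [Nat.zero_le (r * r)]
  set E := 5 * (m * (2 * d - 3 * m)) with hEdef
  set c := 2 * d - 1 with hc
  have hc2 : 4 * d - 2 = 2 * c := by omega
  rw [hc2] at hE'
  -- The factor `4 ^ c` avoids division in the natural numbers.
  have key : 2 ^ (l + 5) * 4 ^ c < q ^ E * 4 ^ c := by
    calc 2 ^ (l + 5) * 4 ^ c = 2 ^ l * (2 ^ 5 * 4 ^ c) := by ring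
      _ ≤ (2 ^ Φ * (2 * (q - 1) ^ c)) * (2 ^ 5 * 4 ^ c) := by
          gcongr
          exact hΦ.trans (by gcongr)
      _ = 2 ^ (Φ + 6) * (4 * (q - 1)) ^ c := by rw [mul_pow]; ring
      _ ≤ 2 ^ (Φ + 6) * (q ^ 2) ^ c := by gcongr
      _ < 2 ^ E * (q ^ 2) ^ c := by
          gcongr
          norm_num
      _ = 2 ^ (E - 2 * c) * 2 ^ (2 * c) * q ^ (2 * c) := by
          rw [← pow_add, ← pow_mul, Nat.sub_add_cancel hE']
      _ ≤ q ^ (E - 2 * c) * 2 ^ (2 * c) * q ^ (2 * c) := by gcongr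
      _ = q ^ (E - 2 * c) * q ^ (2 * c) * 4 ^ c := by
          rw [pow_mul 2 2 c]; norm_num; ring
      _ = q ^ E * 4 ^ c := by rw [← pow_add, Nat.sub_add_cancel hE']
  have h3 : 2 ^ (l + 5) < q ^ E := lt_of_mul_lt_mul_right key (Nat.zero_le _)
  calc 2 ^ (l + 5) < q ^ E := h3
    _ = (q ^ (m * (2 * d - 3 * m))) ^ 5 := by rw [← pow_mul, hEdef, mul_comm]
    _ ≤ n ^ 5 := by gcongr

theorem maxIrredundantBase_lt_of_pairs {Ω : Set (Sym2 (Submodule K V))}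
    (hΩ : LinearlyInvariant Ω) {m : ℕ} (hm : 1 ≤ m) (hmd : 2 * m < finrank K V)
    (hdim : ∀ p ∈ Ω, ∃ U W : Submodule K V, p = s(U, W) ∧ finrank K U = m ∧
      finrank K W = finrank K V - m)
    (hex : ∀ U : Submodule K V, finrank K U = m →
      ∃ W : Submodule K V, finrank K W = finrank K V - m ∧ s(U, W) ∈ Ω)
    (hcard : Nat.card K ^ (m * (2 * finrank K V - 3 * m)) ≤ Nat.card Ω)
    {G : Subgroup (Equiv.Perm Ω)} (hG : IsAlmostSimple G)
    (hsoc : (groupSocle G).map G.subtype = (pslPerm Ω hΩ).range) :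
    (maxIrredundantBase G Ω : ℝ) < 5 * (Real.logb 2 (Nat.card Ω) - 1) := by
  have : Finite V := Module.finite_of_finite K
  have : Finite (Submodule K V) := Finite.of_injective _ SetLike.coe_injective
  have : Finite (Sym2 (Submodule K V)) := Quot.finite _
  obtain ⟨p, hp⟩ := CharP.exists K
  have hpp : Fact p.Prime := ⟨(CharP.char_is_prime_or_zero K p).resolve_right
    (CharP.char_ne_zero_of_finite K p)⟩
  rw [range_pslPerm] at hsoc
  have hmem : ∀ s, slPerm Ω hΩ s ∈ G := by
    intro s
    have : slPerm Ω hΩ s ∈ (groupSocle G).map G.subtype := hsoc ▸ ⟨s, rfl⟩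
    exact Subgroup.map_subtype_le _ this
  let ρ : SpecialLinearGroup K V →* G := (slPerm Ω hΩ).codRestrict G hmem
  have hrange : ρ.range = groupSocle G := by
    apply Subgroup.map_injective G.subtype_injective
    rw [hsoc, MonoidHom.map_range]
    rfl
  have hρ := isCentralEmbedding_of_almostSimple p (hΩ := hΩ) hm hmd hex hG (ρ := ρ)
    (fun _ => rfl) hrange
  obtain ⟨l, hl, hlen⟩ := (isGreatest_maxIrredundantBase G (Ω := Ω)).1
  obtain ⟨h1, h2⟩ := length_bound (hΩ := hΩ) hmd hdim (ρ := ρ) (fun _ => rfl) hl.1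
  have h3 := two_pow_lt_of_bounds Finite.one_lt_card hm hmd
    (hρ.index_range_le (by omega)) h1 h2 hcard
  rw [← hlen]
  have h4 : ((2 : ℝ)) ^ ((l.length + 5 : ℕ) : ℝ) < (Nat.card Ω : ℝ) ^ 5 := by
    rw [Real.rpow_natCast]
    exact_mod_cast h3
  have h5 : 0 < (Nat.card Ω : ℝ) ^ 5 := lt_trans (by positivity) h4
  have h6 := (Real.lt_logb_iff_rpow_lt (by norm_num) h5).2 h4
  rw [Real.logb_pow] at h6
  push_cast at h6
  linarith

end Main

theorem mainTheorem9 (K V : Type*) [Field K] [Finite K] [AddCommGroup V] [Module K V]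
    [FiniteDimensional K V] (d m : ℕ) (hd : Module.finrank K V = d) (hm : 1 ≤ m)
    (hmd : 2 * m < d) :
    (∀ G : Subgroup (Equiv.Perm (complementaryPairs K V m)),
      IsAlmostSimple G →
      (groupSocle G).map G.subtype =
        (pslPerm (complementaryPairs K V m) (complementaryPairs_invariant m)).range →
      (maxIrredundantBase G (complementaryPairs K V m) : ℝ) <
        5 * (Real.logb 2 (Nat.card (complementaryPairs K V m)) - 1)) ∧
    (∀ G : Subgroup (Equiv.Perm (nestedPairs K V m)),
      IsAlmostSimple G →
      (groupSocle G).map G.subtype =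
        (pslPerm (nestedPairs K V m) (nestedPairs_invariant m)).range →
      (maxIrredundantBase G (nestedPairs K V m) : ℝ) <
        5 * (Real.logb 2 (Nat.card (nestedPairs K V m)) - 1)) := by
  subst hd
  obtain ⟨U, -, -, hU⟩ := exists_subspace_between (K := K) (V := V) (bot_le (a := ⊤)) (k := m)
    (by simp) (by rw [finrank_top]; omega)
  constructor
  · intro G hG hsoc
    obtain ⟨W, hUW⟩ := Submodule.exists_isCompl U
    have hW := Submodule.finrank_add_eq_of_isCompl hUW
    refine maxIrredundantBase_lt_of_pairs _ hm hmd ?_ ?_ ?_ hG hsoc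
    · rintro p ⟨U, W, rfl, hU, hW, -⟩
      exact ⟨U, W, rfl, hU, hW⟩
    · intro U hU
      obtain ⟨W, hUW⟩ := Submodule.exists_isCompl U
      have := Submodule.finrank_add_eq_of_isCompl hUW
      exact ⟨W, by omega, U, W, rfl, hU, by omega, hUW⟩
    -- Here the exponent is `2 m (d - m)`, which exceeds the required `m (2d - 3m)`.
    · refine le_trans ?_ (pow_le_card_pairs (complementaryPairs_invariant m)
        (U := U) (W := W) (C := U) (C' := W) (D := W) ⟨U, W, rfl, hU, by omega, hUW⟩
        (by omega) hUW.symm hUW le_rfl le_rfl)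
      refine Nat.pow_le_pow_right Nat.card_pos ?_
      obtain ⟨e, he⟩ : ∃ e, finrank K V = 2 * m + 1 + e :=
        ⟨finrank K V - (2 * m + 1), by omega⟩
      have h1 : 2 * finrank K V - 3 * m = m + 2 + 2 * e := by omega
      have h2 : finrank K W = m + 1 + e := by omega
      rw [h1, h2, hU]
      nlinarith [Nat.zero_le (m * m)]
  · intro G hG hsoc
    obtain ⟨W, hUW, -, hW⟩ := exists_subspace_between (K := K) (V := V) (le_top (a := U))
      (k := finrank K V - m) (by omega) (by rw [finrank_top]; omega)
    obtain ⟨C, hC⟩ := Submodule.exists_isCompl W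
    obtain ⟨D₀, hD₀⟩ := Submodule.exists_isCompl (U.comap W.subtype)
    refine maxIrredundantBase_lt_of_pairs _ hm hmd ?_ ?_ ?_ hG hsoc
    · rintro p ⟨U, W, rfl, hU, hW, -⟩
      exact ⟨U, W, rfl, hU, hW⟩
    · intro U hU
      obtain ⟨W, hUW, -, hW⟩ := exists_subspace_between (K := K) (V := V) (le_top (a := U))
        (k := finrank K V - m) (by omega) (by rw [finrank_top]; omega)
      exact ⟨W, hW, U, W, rfl, hU, hW, hUW⟩
    · set D := D₀.map W.subtype with hD
      have hDW : D ≤ W := Submodule.map_subtype_le W D₀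
      have hUD : U ⊔ D = W := by
        have h := congrArg (Submodule.map W.subtype) hD₀.sup_eq_top
        rwa [Submodule.map_sup, Submodule.map_comap_subtype, Submodule.map_subtype_top,
          inf_eq_right.2 hUW] at h
      have hUD' : U ⊓ D = ⊥ := by
        have h := congrArg (Submodule.map W.subtype) hD₀.inf_eq_bot
        rwa [Submodule.map_inf _ W.injective_subtype, Submodule.map_comap_subtype,
          Submodule.map_bot, inf_eq_right.2 hUW] at h
      have hdimD := Submodule.finrank_sup_add_finrank_inf_eq U D
      rw [hUD, hUD', finrank_bot] at hdimD
      have hdimC := Submodule.finrank_add_eq_of_isCompl hC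
      have hUC : IsCompl U (D ⊔ C) := by
        refine IsCompl.of_eq ?_ (by rw [← sup_assoc, hUD, hC.sup_eq_top])
        have hdj : Disjoint (U ⊔ D) C := by rw [hUD]; exact hC.disjoint
        exact (Disjoint.disjoint_sup_right_of_disjoint_sup_left
          (disjoint_iff.2 hUD') hdj).eq_bot
      -- With `dim C = m` and `dim D = d - 2m` the exponent is exactly `m (2d - 3m)`; the nested
      -- case dictates this value.
      refine le_trans ?_ (pow_le_card_pairs (nestedPairs_invariant m)
        (U := U) (W := W) (C := C) (C' := D ⊔ C) (D := D) ⟨U, W, rfl, hU, hW, hUW⟩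
        (by omega) hC hUC le_sup_left hDW)
      refine Nat.pow_le_pow_right Nat.card_pos ?_
      obtain ⟨e, he⟩ : ∃ e, finrank K V = 2 * m + 1 + e :=
        ⟨finrank K V - (2 * m + 1), by omega⟩
      have h1 : 2 * finrank K V - 3 * m = m + 2 + 2 * e := by omega
      have h2 : finrank K W = m + 1 + e := by omega
      have h3 : finrank K D = 1 + e := by omega
      have h4 : finrank K C = m := by omega
      rw [h1, h2, h3, h4, hU]
      exact le_of_eq (by ring)
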